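/- Let $N\ge 0$, let $0<\lambda_1<\lambda_2<\dots<\lambda_{2N+1}$, and put $$\Gamma^+=[0,\lambda_1]\cup[\lambda_2,\lambda_3]\cup\dots\cup[\lambda_{2N},\lambda_{2N+1}],\qquad \Gamma=\Gamma^+\cup(-\Gamma^+).$$ Let $R(\eta)=\sqrt{(\eta^2-\lambda_1^2)(\eta^2-\lambda_2^2)\cdots(\eta^2-\lambda_{2N+1}^2)}$ be the branch that is holomorphic on $\mathbb C\setminus\Gamma$ with $R(\eta)\sim\eta^{2N+1}$ as $\eta\to\infty$; for $\eta\in\Gamma$ the value $R(\eta)$ is taken on the upper shore of the cut. Consider $$dp=\frac{iP(\eta)}{\pi R(\eta)}\,d\eta,\qquad dq=\frac{12\,iQ(\eta)}{\pi R(\eta)}\,d\eta,$$ where $P$ and $Q$ are odd monic polynomials with complex coefficients, of degrees $2N+1$ and $2N+3$, such that $$\int_{\lambda_{2j-1}}^{\lambda_{2j}}dp=\int_{\lambda_{2j-1}}^{\lambda_{2j}}dq=0,\qquad j=1,\dots,N,$$ and such that $dq$ has no constant term at infinity, i.e. $Q(\eta)/R(\eta)-\eta^2\to0$ as $\eta\to\infty$.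 Theorem. These conditions determine $P$ and $Q$ uniquely (and such $P$, $Q$ exist). Put $u=dp/d\eta$ and $v=dq/d\eta$. Then, with all pointwise claims about $u$, $v$ and the Hilbert transform understood away from the endpoints $\pm\lambda_j$ (where $R=0$): 1. $u$ and $v$ are odd and real valued on $\Gamma$. 2. $u$ and $v$ are integrable on $\Gamma$, and $$H[u](\eta)=\frac1\pi,\qquad H[v](\eta)=\frac{12\eta^2}{\pi}\qquad\text{for }\eta\in\Gamma,$$ where $H[f](\xi)=\frac1\pi\,\mathrm{p.v.}\!\int_\Gamma\frac{f(y)\,dy}{y-\xi}$ is the finite Hilbert transform on $\Gamma$. 3. $u$ and $v$ solve the soliton gas dispersion relations with $\sigma=0$: for every $\eta\in\Gamma^+$ (endpoints included), with absolutely convergent integrals, $$\int_{\Gamma^+}\ln\left|\frac{\mu+\eta}{\mu-\eta}\right|u(\mu)\,d\mu=\eta,\qquad \int_{\Gamma^+}\ln\left|\frac{\mu+\eta}{\mu-\eta}\right|v(\mu)\,d\mu=4\eta^3.$$ 4. $u(\eta)\ge0$ on $\Gamma^+$. -/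

import Mathlib

open Filter Topology MeasureTheory Polynomial

namespace SolitonCondensate

noncomputable section

/-- The branch of `√((z - a)(z - b))` with branch cut `[a, b]` that behaves like `z` at infinity.
The power is the principal one. For real `z` strictly between `a` and `b` it takes the value
`i √((z - a)(b - z))`, the limit from the upper half plane (see `tendsto_root_upper`). -/
def bandRoot (a b : ℝ) (z : ℂ) : ℂ :=
  (z - a) * ((z - b) / (z - a)) ^ (1 / 2 : ℂ)

/-- `Γ⁺ = [0, λ₁] ∪ [λ₂, λ₃] ∪ … ∪ [λ_{2N}, λ_{2N+1}]`. Only `lam 1, …, lam (2 * N + 1)` are used,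
here and below. -/
def bandsPos (N : ℕ) (lam : ℕ → ℝ) : Set ℝ :=
  Set.Icc 0 (lam 1) ∪ ⋃ k ∈ Finset.Icc 1 N, Set.Icc (lam (2 * k)) (lam (2 * k + 1))

/-- `Γ = Γ⁺ ∪ (-Γ⁺)`. -/
def bands (N : ℕ) (lam : ℕ → ℝ) : Set ℝ :=
  bandsPos N lam ∪ {x | -x ∈ bandsPos N lam}

/-- The branch points `±λ₁, …, ±λ_{2N+1}`. -/
def branchPoints (N : ℕ) (lam : ℕ → ℝ) : Set ℝ :=
  {x | ∃ j ∈ Finset.Icc 1 (2 * N + 1), x = lam j ∨ x = -lam j}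

/-- `R(z) = √((z² - λ₁²) ⋯ (z² - λ_{2N+1}²))`, the branch on the plane cut along `Γ` that behaves
like `z ^ (2 N + 1)` at infinity. On `Γ` its value is the one on the upper shore of the cut. The
lemmas below confirm each of these properties. -/
def root (N : ℕ) (lam : ℕ → ℝ) (z : ℂ) : ℂ :=
  bandRoot (-lam 1) (lam 1) z *
    ∏ k ∈ Finset.Icc 1 N,
      (bandRoot (lam (2 * k)) (lam (2 * k + 1)) z *
        bandRoot (-lam (2 * k + 1)) (-lam (2 * k)) z)

/-- `dp/dη = i P(η) / (π R(η))`. -/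
def dp (N : ℕ) (lam : ℕ → ℝ) (P : ℂ[X]) (z : ℂ) : ℂ :=
  Complex.I * P.eval z / (Real.pi * root N lam z)

/-- `dq/dη = 12 i Q(η) / (π R(η))`. -/
def dq (N : ℕ) (lam : ℕ → ℝ) (Q : ℂ[X]) (z : ℂ) : ℂ :=
  12 * Complex.I * Q.eval z / (Real.pi * root N lam z)

/-- `p` is a monic odd polynomial of degree `d`. -/
def IsOddMonic (d : ℕ) (p : ℂ[X]) : Prop :=
  p.Monic ∧ p.natDegree = d ∧ p.comp (-X) = -p

/-- All the integrals of `f(η) dη` over the gaps `(λ_{2j-1}, λ_{2j})`, `1 ≤ j ≤ N`, vanish. -/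
def GapIntegralsVanish (N : ℕ) (lam : ℕ → ℝ) (f : ℂ → ℂ) : Prop :=
  ∀ j ∈ Finset.Icc 1 N, ∫ x in (lam (2 * j - 1))..(lam (2 * j)), f (x : ℂ) = 0

/-- `P` is the numerator of the normalized differential `dp`. -/
def IsNumeratorP (N : ℕ) (lam : ℕ → ℝ) (P : ℂ[X]) : Prop :=
  IsOddMonic (2 * N + 1) P ∧ GapIntegralsVanish N lam (dp N lam P)

/-- `Q` is the numerator of the normalized differential `dq`. The singular part of `dq` at infinity
is that of `(12 i / π) η² dη`: there is no term `const · dη`. -/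
def IsNumeratorQ (N : ℕ) (lam : ℕ → ℝ) (Q : ℂ[X]) : Prop :=
  IsOddMonic (2 * N + 3) Q ∧ GapIntegralsVanish N lam (dq N lam Q) ∧
    Tendsto (fun z : ℂ => dq N lam Q z - 12 * Complex.I / Real.pi * z ^ 2)
      (Bornology.cobounded ℂ) (𝓝 0)

/-- The finite Hilbert transform `(1/π) ∫_G f(y) / (y - ξ) dy` exists at `ξ`, as a Cauchy principal
value, and equals `a`. -/
def HasHilbertTransform (G : Set ℝ) (f : ℝ → ℂ) (ξ : ℝ) (a : ℂ) : Prop :=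
  Tendsto
    (fun ε : ℝ => (1 / Real.pi : ℂ) * ∫ y in G \ Set.Ioo (ξ - ε) (ξ + ε), f y / ((y : ℂ) - ξ))
    (𝓝[>] 0) (𝓝 a)

/-- `f` solves the dispersion relation
`∫_G log |(μ + η) / (μ - η)| f(μ) dμ + f(η) σ(η) = g(η)` for all `η ∈ G`, with absolutely
convergent integrals. -/
def SolvesNDR (G : Set ℝ) (σ : ℝ → ℝ) (g : ℝ → ℝ) (f : ℝ → ℂ) : Prop :=
  ∀ η ∈ G,
    IntegrableOn (fun μ : ℝ => (Real.log |(μ + η) / (μ - η)| : ℂ) * f μ) G ∧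
    (∫ μ in G, (Real.log |(μ + η) / (μ - η)| : ℂ) * f μ) + f η * σ η = g η

theorem bandRoot_sq (a b : ℝ) (z : ℂ) : bandRoot a b z ^ 2 = (z - a) * (z - b) := by
  unfold bandRoot
  rw [mul_pow, ← Complex.cpow_nat_mul]
  by_cases h : z - a = 0
  · simp [h]
  · norm_num
    field_simp

theorem root_sq (N : ℕ) (lam : ℕ → ℝ) (z : ℂ) :
    root N lam z ^ 2 = ∏ j ∈ Finset.Icc 1 (2 * N + 1), (z ^ 2 - (lam j : ℂ) ^ 2) := by
  unfold root
  rw [mul_pow, ← Finset.prod_pow]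
  simp only [mul_pow, bandRoot_sq]
  induction N with
  | zero => simp; ring
  | succ n ih =>
    rw [Finset.prod_Icc_succ_top (by omega), ← mul_assoc, ih,
      show 2 * (n + 1) + 1 = (2 * n + 1) + 1 + 1 by ring,
      Finset.prod_Icc_succ_top (b := 2 * n + 1 + 1) (by omega),
      Finset.prod_Icc_succ_top (b := 2 * n + 1) (by omega),
      show 2 * (n + 1) = 2 * n + 1 + 1 by ring]
    push_cast
    ring

theorem differentiableAt_bandRoot {a b : ℝ} {z : ℂ}
    (hz : ∀ x : ℝ, a ≤ x → x ≤ b → z ≠ x) (hab : a < b) :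
    DifferentiableAt ℂ (bandRoot a b) z := by
  have hza : z - a ≠ 0 := sub_ne_zero.2 (hz a le_rfl hab.le)
  have hslit : (z - b) / (z - a) ∈ Complex.slitPlane := by
    rw [Complex.mem_slitPlane_iff]
    by_contra hcon
    push Not at hcon
    obtain ⟨hre, him⟩ := hcon
    set t : ℝ := ((z - b) / (z - a)).re with ht
    have hw : (z - b) / (z - a) = (t : ℂ) := Complex.ext (by simp [ht]) (by simp [him])
    rw [div_eq_iff hza] at hw
    have h1 : (1 - t : ℝ) ≠ 0 := by linarith
    have hzt : z = (((b - t * a) / (1 - t) : ℝ) : ℂ) := by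
      push_cast
      have h1' : (1 - t : ℂ) ≠ 0 := by exact_mod_cast h1
      rw [eq_div_iff h1']
      linear_combination hw
    refine hz _ ?_ ?_ hzt
    · rw [le_div_iff₀ (by linarith)]; nlinarith
    · rw [div_le_iff₀ (by linarith)]; nlinarith
  have hid : DifferentiableAt ℂ (fun w : ℂ => w) z := differentiableAt_id
  unfold bandRoot
  exact (hid.sub_const _).mul
    (((hid.sub_const _).div (hid.sub_const _) hza).cpow (differentiableAt_const _) hslit)

/-- `R` is holomorphic off the cuts. -/
theorem differentiableAt_root {N : ℕ} {lam : ℕ → ℝ} (hpos : 0 < lam 1)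
    (hmono : StrictMonoOn lam (Set.Icc 1 (2 * N + 1))) {z : ℂ}
    (hz : ∀ x ∈ bands N lam, z ≠ (x : ℂ)) : DifferentiableAt ℂ (root N lam) z := by
  unfold root
  refine (differentiableAt_bandRoot (fun x h1 h2 => hz x ?_) (by linarith)).mul ?_
  · rcases le_total 0 x with h | h
    · exact Or.inl (Or.inl ⟨h, h2⟩)
    · exact Or.inr (Or.inl ⟨by linarith, by linarith⟩)
  · refine DifferentiableAt.fun_finsetProd fun k hk => ?_
    have hk' := Finset.mem_Icc.1 hk
    have hlt : lam (2 * k) < lam (2 * k + 1) :=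
      hmono ⟨by omega, by omega⟩ ⟨by omega, by omega⟩ (by omega)
    refine (differentiableAt_bandRoot (fun x h1 h2 => hz x ?_) hlt).mul
      (differentiableAt_bandRoot (fun x h1 h2 => hz x ?_) (by linarith))
    · exact Or.inl (Or.inr (Set.mem_biUnion hk ⟨h1, h2⟩))
    · exact Or.inr (Or.inr (Set.mem_biUnion hk ⟨by linarith, by linarith⟩))

theorem tendsto_bandRoot_upper {a b x : ℝ} (hab : a < b) (ha : x ≠ a) (hb : x ≠ b) :
    Tendsto (bandRoot a b) (𝓝[{z : ℂ | 0 < z.im}] (x : ℂ)) (𝓝 (bandRoot a b x)) := by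
  by_cases hx : a < x ∧ x < b
  · have hxa : (x : ℂ) - a ≠ 0 := by exact_mod_cast sub_ne_zero.2 ha
    have hval : ((x : ℂ) - b) / (x - a) = (((x - b) / (x - a) : ℝ) : ℂ) := by push_cast; rfl
    have hneg : (x - b) / (x - a) < 0 := div_neg_of_neg_of_pos (by linarith) (by linarith)
    have hw0 : ((x : ℂ) - b) / (x - a) ≠ 0 := by
      rw [hval]; exact_mod_cast hneg.ne
    have hcont : Tendsto (fun z : ℂ => (z - b) / (z - a)) (𝓝[{z : ℂ | 0 < z.im}] (x : ℂ))
        (𝓝[{w : ℂ | 0 ≤ w.im}] (((x : ℂ) - b) / (x - a))) := by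
      refine tendsto_nhdsWithin_iff.2 ⟨?_, ?_⟩
      · have hid : Tendsto (fun z : ℂ => z) (𝓝[{z : ℂ | 0 < z.im}] (x : ℂ)) (𝓝 (x : ℂ)) :=
          tendsto_id.mono_left nhdsWithin_le_nhds
        exact (hid.sub_const _).div (hid.sub_const _) hxa
      · filter_upwards [self_mem_nhdsWithin] with z hz
        have hz' : 0 < z.im := hz
        have hn : 0 < Complex.normSq (z - a) := by
          apply Complex.normSq_pos.2
          intro h
          have := congrArg Complex.im h
          simp at this
          linarith
        show 0 ≤ ((z - b) / (z - a)).im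
        rw [Complex.div_im, ← sub_div]
        refine div_nonneg ?_ hn.le
        simp
        nlinarith
    have hlog : Tendsto Complex.log (𝓝[{w : ℂ | 0 ≤ w.im}] (((x : ℂ) - b) / (x - a)))
        (𝓝 (Complex.log (((x : ℂ) - b) / (x - a)))) := by
      rw [hval]
      exact Complex.continuousWithinAt_log_of_re_neg_of_im_zero (by rw [Complex.ofReal_re]; exact hneg)
        (Complex.ofReal_im _)
    have hev : bandRoot a b =ᶠ[𝓝[{z : ℂ | 0 < z.im}] (x : ℂ)] fun z =>
        (z - a) * Complex.exp (Complex.log ((z - b) / (z - a)) * (1 / 2)) := by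
      filter_upwards [self_mem_nhdsWithin] with z hz
      have hz' : 0 < z.im := hz
      have h1 : z - a ≠ 0 := by
        intro h
        have := congrArg Complex.im h
        simp at this
        linarith
      have h2 : z - b ≠ 0 := by
        intro h
        have := congrArg Complex.im h
        simp at this
        linarith
      rw [bandRoot, Complex.cpow_def_of_ne_zero (div_ne_zero h2 h1)]
    have hx' : bandRoot a b x =
        ((x : ℂ) - a) * Complex.exp (Complex.log (((x : ℂ) - b) / (x - a)) * (1 / 2)) := by
      rw [bandRoot, Complex.cpow_def_of_ne_zero hw0]
    rw [hx']
    refine Tendsto.congr' hev.symm ?_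
    have hid : Tendsto (fun z : ℂ => z) (𝓝[{z : ℂ | 0 < z.im}] (x : ℂ)) (𝓝 (x : ℂ)) :=
      tendsto_id.mono_left nhdsWithin_le_nhds
    exact (hid.sub_const _).mul
      ((Complex.continuous_exp.tendsto _).comp ((hlog.comp hcont).mul_const _))
  · refine (differentiableAt_bandRoot (fun y h1 h2 h => hx ?_) hab).continuousAt.tendsto.mono_left
      nhdsWithin_le_nhds
    have hxy : x = y := by exact_mod_cast h
    subst hxy
    exact ⟨lt_of_le_of_ne h1 ha.symm, lt_of_le_of_ne h2 hb⟩

/-- On the real line, away from the branch points, `R` is its own limit from the upper half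
plane. -/
theorem tendsto_root_upper {N : ℕ} {lam : ℕ → ℝ} (hpos : 0 < lam 1)
    (hmono : StrictMonoOn lam (Set.Icc 1 (2 * N + 1))) {x : ℝ} (hx : x ∉ branchPoints N lam) :
    Tendsto (root N lam) (𝓝[{z : ℂ | 0 < z.im}] (x : ℂ)) (𝓝 (root N lam x)) := by
  have hne : ∀ j, 1 ≤ j → j ≤ 2 * N + 1 → x ≠ lam j ∧ x ≠ -lam j := fun j h1 h2 =>
    ⟨fun h => hx ⟨j, Finset.mem_Icc.2 ⟨h1, h2⟩, Or.inl h⟩,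
      fun h => hx ⟨j, Finset.mem_Icc.2 ⟨h1, h2⟩, Or.inr h⟩⟩
  unfold root
  have h1 := hne 1 le_rfl (by omega)
  refine Tendsto.mul ?_ (tendsto_finsetProd _ fun k hk => ?_)
  · exact tendsto_bandRoot_upper (by linarith) (by simpa using h1.2) h1.1
  · have hk' := Finset.mem_Icc.1 hk
    have hlt : lam (2 * k) < lam (2 * k + 1) :=
      hmono ⟨by omega, by omega⟩ ⟨by omega, by omega⟩ (by omega)
    have h2 := hne (2 * k) (by omega) (by omega)
    have h3 := hne (2 * k + 1) (by omega) (by omega)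
    refine (tendsto_bandRoot_upper hlt h2.1 h3.1).mul
      (tendsto_bandRoot_upper (by linarith) (by simpa using h3.2) (by simpa using h2.2))

theorem tendsto_bandRoot_div (a b : ℝ) :
    Tendsto (fun z : ℂ => bandRoot a b z / z) (Bornology.cobounded ℂ) (𝓝 1) := by
  have hinv : Tendsto (fun z : ℂ => z⁻¹) (Bornology.cobounded ℂ) (𝓝 0) :=
    tendsto_inv₀_cobounded
  have hA : Tendsto (fun z : ℂ => 1 - (a : ℂ) * z⁻¹) (Bornology.cobounded ℂ) (𝓝 1) := by
    simpa using (hinv.const_mul (a : ℂ)).const_sub 1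
  have hB : Tendsto (fun z : ℂ => 1 - (b : ℂ) * z⁻¹) (Bornology.cobounded ℂ) (𝓝 1) := by
    simpa using (hinv.const_mul (b : ℂ)).const_sub 1
  have hq := hB.div hA one_ne_zero
  rw [div_one] at hq
  have hc := hA.mul (hq.cpow (tendsto_const_nhds (x := (1 / 2 : ℂ))) (by simp))
  rw [Complex.one_cpow, one_mul] at hc
  refine hc.congr' ?_
  have h0 : ∀ᶠ z : ℂ in Bornology.cobounded ℂ, z ≠ 0 :=
    Bornology.eventually_ne_cobounded 0
  filter_upwards [h0] with z hz
  have e : ∀ c : ℝ, 1 - (c : ℂ) * z⁻¹ = (z - c) / z := fun c => by field_simp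
  simp only [Pi.div_apply, e, bandRoot]
  rw [div_div_div_cancel_right₀ hz]
  ring

/-- `R(z) ∼ z ^ (2 N + 1)` at infinity. -/
theorem tendsto_root_div (N : ℕ) (lam : ℕ → ℝ) :
    Tendsto (fun z : ℂ => root N lam z / z ^ (2 * N + 1)) (Bornology.cobounded ℂ) (𝓝 1) := by
  have h := (tendsto_bandRoot_div (-lam 1) (lam 1)).mul
    (tendsto_finsetProd (Finset.Icc 1 N) fun k _ =>
      (tendsto_bandRoot_div (lam (2 * k)) (lam (2 * k + 1))).mul
        (tendsto_bandRoot_div (-lam (2 * k + 1)) (-lam (2 * k))))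
  simp only [mul_one, Finset.prod_const_one] at h
  refine h.congr fun z => ?_
  simp only [root, div_mul_div_comm, Finset.prod_div_distrib, Finset.prod_const, Nat.card_Icc]
  push_cast
  congr 1
  ring

end

end SolitonCondensate

namespace SolitonCondensate

open Asymptotics

/-! On the upper shore of `Γ` the root `R` is purely imaginary, and on the rest of the real line it
is real. For a real polynomial `S` the function `i S / R` is therefore real on `Γ` and purely
imaginary off it. Let `T` be its polynomial part at infinity up to the factor `i`, that is, `1 / π`
for `dp` and `12 z² / π` for `dq`. Then `f = i S / R - i T` is holomorphic in the upper half plane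
and tends to zero at infinity. On the real line `Re f` is the density on `Γ` and zero elsewhere,
while `Im f = -T` on `Γ`. Both integral equations come from Cauchy's theorem in the upper half plane
(`HasDominatedBoundary.tendsto_integral`).

Hilbert transform: `f / (z - ξ)`, with the pole at `ξ` removed by a decaying correction, has real
part whose symmetric integrals give `H[Re f](ξ) = -Im f(ξ) = T(ξ)` (`hasHilbertTransform_density`).

Dispersion relation: the product of `f` with `log (z + η) - log (z - η)` decays faster than `1 / z`.
The imaginary part of the kernel is `-π` on `(-η, η)` and zero outside, so the integral of the
logarithm against the density over `Γ⁺` is `π / 2` times the integral of `T - Im (i S / R)` over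
`(-η, η)` (`integral_log_mul_density`). The term `Im (i S / R)` vanishes on the bands and has zero
integral over each gap, so it contributes nothing when `η` lies in a band. The integral of `T` gives
`η` and `4 η³`.

Uniqueness and existence: a real `S` with zero integral over a gap has a zero inside that gap, since
`S / R` is real and continuous there. An odd `S` of degree at most `2 N` satisfying all gap
conditions then has the `2 N + 1` zeros `0, ±a_j`, so it is zero (`eq_zero_of_odd_of_gapIntegral`).
This gives uniqueness, and also existence, because the gap conditions form a square linear system.
By uniqueness the complex numerators `P` and `Q` are in fact real.

Positivity: the numerator of `dp` has exactly one zero `a_j` in each gap, so `S = X ∏ (X² - a_j²)`,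
and its sign changes match those of `R` (`density_re_nonneg`). -/

/-! ### Local integrability of power and logarithmic singularities -/

theorem locallyIntegrable_abs_sub_rpow (c : ℝ) {α : ℝ} (hα : -1 < α) :
    LocallyIntegrable (fun x : ℝ => |x - c| ^ α) := by
  have h : LocallyIntegrable (fun x : ℝ => |x| ^ α) := by
    refine locallyIntegrable_of_norm_le_rpow (C := 1) (α := -α) (by simp) (by simp; linarith)
      (Eventually.of_forall fun x => ?_) ?_
    · rw [one_mul, neg_neg, Real.norm_eq_abs, Real.norm_eq_abs, abs_of_nonneg (by positivity)]
    · exact (measurable_id.abs.pow_const α).aestronglyMeasurable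
  intro x
  obtain ⟨s, hs, hi⟩ := h (x - c)
  refine ⟨(fun y => y - c) ⁻¹' s, (continuous_sub_right c).continuousAt hs, ?_⟩
  exact ((measurePreserving_sub_right volume c).integrableOn_comp_preimage
    (Homeomorph.subRight c).measurableEmbedding).2 hi

/-- Near a given point at most one factor is singular; the others are continuous there. -/
theorem locallyIntegrable_prod_abs_sub_rpow (s : Finset ℝ) {α : ℝ} (hα : -1 < α) :
    LocallyIntegrable (fun x : ℝ => ∏ c ∈ s, |x - c| ^ α) := by
  intro x₀
  set t := s.erase x₀ with ht
  have hopen : IsOpen ((t : Set ℝ)ᶜ) := t.finite_toSet.isClosed.isOpen_compl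
  have hcont : ContinuousOn (fun x : ℝ => ∏ c ∈ t, |x - c| ^ α) (t : Set ℝ)ᶜ := by
    refine continuousOn_finsetProd _ fun c hc => ?_
    refine ContinuousOn.rpow_const (by fun_prop) fun x hx => Or.inl ?_
    rw [abs_ne_zero, sub_ne_zero]
    rintro rfl
    exact hx hc
  have key : LocallyIntegrableOn (fun x : ℝ => ∏ c ∈ s, |x - c| ^ α) (t : Set ℝ)ᶜ := by
    by_cases hx : x₀ ∈ s
    · simp_rw [← Finset.prod_erase_mul s _ hx]
      exact ((locallyIntegrable_abs_sub_rpow x₀ hα).locallyIntegrableOn _).continuousOn_mul hcont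
        hopen.isLocallyClosed
    · rw [ht, Finset.erase_eq_of_notMem hx] at hcont hopen ⊢
      exact hcont.locallyIntegrableOn hopen.measurableSet
  have := key x₀ (by simp [ht])
  rwa [hopen.nhdsWithin_eq (by simp [ht])] at this

/-- Young's inequality for the exponents `3/2` and `3`, without the constants. It separates the
singularity of `1 / R` from that of the logarithm, which may sit at the same branch point: with `a =
1 / |R|` and `b = |x - c| ^ (-1/4)` both terms on the right have singularities of order `3/4`. -/
theorem mul_le_rpow_add_pow {a b : ℝ} (ha : 0 ≤ a) (hb : 0 ≤ b) :
    a * b ≤ a ^ (3 / 2 : ℝ) + b ^ 3 := by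
  have h32 : a ^ (3 / 2 : ℝ) = a * Real.sqrt a := by
    rcases ha.eq_or_lt with rfl | h
    · simp
    · rw [Real.sqrt_eq_rpow, show (3 / 2 : ℝ) = 1 + 1 / 2 by norm_num, Real.rpow_add h,
        Real.rpow_one]
  have hs := Real.sqrt_nonneg a
  have hsq := Real.sq_sqrt ha
  rw [h32]
  rcases le_total b (Real.sqrt a) with h | h
  · have := mul_le_mul_of_nonneg_left h ha
    have : 0 ≤ b ^ 3 := by positivity
    linarith
  · have h1 : a ≤ b ^ 2 := by nlinarith
    have := mul_le_mul_of_nonneg_right h1 hb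
    have : 0 ≤ a * Real.sqrt a := by positivity
    nlinarith

theorem abs_log_le_rpow {t : ℝ} (ht : 0 < t) :
    |Real.log t| ≤ 4 * (t + 1) + 4 * t ^ (-(1 / 4) : ℝ) := by
  have h1 := Real.log_le_sub_one_of_pos ht
  have h2 := Real.log_le_rpow_div (inv_pos.2 ht).le (show (0 : ℝ) < 1 / 4 by norm_num)
  rw [Real.log_inv, Real.inv_rpow ht.le, ← Real.rpow_neg ht.le] at h2
  have h3 : 0 ≤ t ^ (-(1 / 4) : ℝ) := by positivity
  rw [abs_le]
  constructor <;> [(norm_num at h2 h3 ⊢; linarith); linarith]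

theorem locallyIntegrable_re {f : ℝ → ℂ} (hf : LocallyIntegrable f) :
    LocallyIntegrable fun x => (f x).re := fun x =>
  let ⟨s, hs, hi⟩ := hf x
  ⟨s, hs, hi.re⟩

theorem locallyIntegrable_im {f : ℝ → ℂ} (hf : LocallyIntegrable f) :
    LocallyIntegrable fun x => (f x).im := fun x =>
  let ⟨s, hs, hi⟩ := hf x
  ⟨s, hs, hi.im⟩

theorem intervalIntegrable_of_locallyIntegrable {E : Type*} [NormedAddCommGroup E] {f : ℝ → E}
    (h : LocallyIntegrable f) (a b : ℝ) : IntervalIntegrable f volume a b :=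
  (h.integrableOn_isCompact isCompact_uIcc).intervalIntegrable

/-! ### Cauchy's theorem in the upper half plane, up to the real line -/

section UpperHalfPlane

variable {g : ℂ → ℂ}

/-- The boundary values on the real line of a function on the upper half plane that is dominated
by a locally integrable function of the real part. -/
structure HasDominatedBoundary (g : ℂ → ℂ) : Prop where
  differentiableOn : DifferentiableOn ℂ g {z | 0 < z.im}
  dominated : ∀ B : ℝ, ∃ G : ℝ → ℝ, LocallyIntegrable G ∧
    ∀ᵐ x : ℝ, ∀ δ : ℝ, 0 < δ → ‖(x + δ * Complex.I : ℂ)‖ ≤ B → ‖g (x + δ * Complex.I)‖ ≤ G x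
  tendsto : ∀ᵐ x : ℝ, Tendsto (fun δ : ℝ => g (x + δ * Complex.I)) (𝓝[>] 0) (𝓝 (g x))

theorem continuous_comp_add_mul_I (hg : DifferentiableOn ℂ g {z | 0 < z.im}) {δ : ℝ}
    (hδ : 0 < δ) : Continuous fun x : ℝ => g (x + δ * Complex.I) := by
  refine hg.continuousOn.comp_continuous (by fun_prop) fun x => ?_
  simpa using hδ

theorem norm_ofReal_add_mul_I_le {ξ A x δ : ℝ} (hx : x ∈ Set.Icc (ξ - A) (ξ + A))
    (hδ : δ ∈ Set.Ioc 0 A) : ‖(x + δ * Complex.I : ℂ)‖ ≤ |ξ| + 2 * A := by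
  have h1 : |x| ≤ |ξ| + A := by
    rw [abs_le]
    constructor <;> linarith [hx.1, hx.2, neg_abs_le ξ, le_abs_self ξ]
  refine (norm_add_le _ _).trans ?_
  rw [norm_mul, Complex.norm_I, Complex.norm_real, Complex.norm_real, Real.norm_eq_abs,
    Real.norm_eq_abs, abs_of_pos hδ.1]
  linarith [hδ.2]

/-- The boundary function is measurable as an almost everywhere limit of the continuous functions on
the horizontal lines above it, and it inherits their dominating function. -/
theorem HasDominatedBoundary.locallyIntegrable (hg : HasDominatedBoundary g) :
    LocallyIntegrable fun x : ℝ => g x := by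
  have hmeas : AEStronglyMeasurable (fun x : ℝ => g x) volume := by
    obtain ⟨v, -, hv0, hv⟩ := exists_seq_strictAnti_tendsto (0 : ℝ)
    refine aestronglyMeasurable_of_tendsto_ae (f := fun (n : ℕ) (x : ℝ) => g (x + v n * Complex.I))
      atTop (fun n =>
        (continuous_comp_add_mul_I hg.differentiableOn (hv0 n)).aestronglyMeasurable) ?_
    filter_upwards [hg.tendsto] with x hx
    exact hx.comp (tendsto_nhdsWithin_iff.2 ⟨hv, Eventually.of_forall hv0⟩)
  rw [locallyIntegrable_iff]
  intro K hK
  obtain ⟨B, hB⟩ := hK.isBounded.exists_norm_le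
  obtain ⟨G, hG, hle⟩ := hg.dominated (B + 1)
  refine Integrable.mono' (hG.integrableOn_isCompact hK) hmeas.restrict ?_
  refine (ae_restrict_iff' hK.measurableSet).2 ?_
  filter_upwards [hle, hg.tendsto] with x h1 h2 hxK
  refine le_of_tendsto h2.norm ?_
  filter_upwards [Ioo_mem_nhdsGT (show (0 : ℝ) < 1 by norm_num)] with δ hδ
  refine h1 δ hδ.1 ((norm_add_le _ _).trans ?_)
  rw [norm_mul, Complex.norm_I, Complex.norm_real, Complex.norm_real, Real.norm_eq_abs δ,
    abs_of_pos hδ.1]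
  linarith [hB x hxK, hδ.2]

/-- Cauchy's theorem for the rectangle over `[ξ - A, ξ + A]` between the heights `δ` and `A`. The
other three sides stay at distance at least `A` from `ξ` and have total length at most `4 A`. -/
theorem norm_integral_line_le (hg : DifferentiableOn ℂ g {z | 0 < z.im}) {ξ A M δ : ℝ}
    (hδ : δ ∈ Set.Ioc 0 A) (hM : ∀ z : ℂ, 0 < z.im → A ≤ ‖z - ξ‖ → ‖g z‖ ≤ M) :
    ‖∫ x in (ξ - A)..(ξ + A), g (x + δ * Complex.I)‖ ≤ 4 * A * M := by
  have hA : 0 < A := hδ.1.trans_le hδ.2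
  have hM0 : 0 ≤ M := by
    refine (norm_nonneg _).trans (hM (ξ + A * Complex.I) (by simpa using hA) ?_)
    simp [abs_of_pos hA]
  have hrect := Complex.integral_boundary_rect_eq_zero_of_differentiableOn g
    ⟨ξ - A, δ⟩ ⟨ξ + A, A⟩ (hg.mono fun z hz => by
      have := hz.2
      rw [Set.mem_preimage, Set.uIcc_of_le hδ.2] at this
      exact hδ.1.trans_le this.1)
  simp only at hrect
  have htop : ‖∫ x in (ξ - A)..(ξ + A), g (x + A * Complex.I)‖ ≤ M * |(ξ + A) - (ξ - A)| := by
    refine intervalIntegral.norm_integral_le_of_norm_le_const fun x _ => hM _ (by simpa using hA) ?_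
    refine le_trans ?_ (Complex.abs_im_le_norm _)
    simp [abs_of_pos hA]
  have hside : ∀ c : ℝ, A ≤ |c - ξ| →
      ‖Complex.I • ∫ y in δ..A, g (c + y * Complex.I)‖ ≤ M * |A - δ| := by
    intro c hc
    rw [norm_smul, Complex.norm_I, one_mul]
    refine intervalIntegral.norm_integral_le_of_norm_le_const fun y hy => hM _ ?_ ?_
    · rw [Set.uIoc_of_le hδ.2] at hy
      simpa using hδ.1.trans hy.1
    · refine hc.trans (le_trans ?_ (Complex.abs_re_le_norm _))
      simp
  have h1 := hside (ξ + A) (by simp [abs_of_pos hA])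
  have h2 := hside (ξ - A) (by simp [abs_of_pos hA])
  have e1 : |(ξ + A) - (ξ - A)| = 2 * A := by rw [abs_of_nonneg] <;> linarith
  have e2 : |A - δ| = A - δ := abs_of_nonneg (by linarith [hδ.2])
  rw [e1] at htop
  rw [e2] at h1 h2
  have heq : (∫ x in (ξ - A)..(ξ + A), g (x + δ * Complex.I)) =
      (∫ x in (ξ - A)..(ξ + A), g (x + A * Complex.I)) -
        (Complex.I • ∫ y in δ..A, g ((ξ + A : ℝ) + y * Complex.I)) +
        Complex.I • ∫ y in δ..A, g ((ξ - A : ℝ) + y * Complex.I) := by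
    linear_combination hrect
  rw [heq]
  refine (norm_add_le _ _).trans ?_
  have h3 := norm_sub_le (∫ x in (ξ - A)..(ξ + A), g (x + A * Complex.I))
    (Complex.I • ∫ y in δ..A, g ((ξ + A : ℝ) + y * Complex.I))
  have := mul_nonneg hM0 hδ.1.le
  nlinarith

theorem HasDominatedBoundary.norm_integral_le (hg : HasDominatedBoundary g) {ξ A M : ℝ}
    (hA : 0 < A) (hM : ∀ z : ℂ, 0 < z.im → A ≤ ‖z - ξ‖ → ‖g z‖ ≤ M) :
    ‖∫ x in (ξ - A)..(ξ + A), g x‖ ≤ 4 * A * M := by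
  obtain ⟨G, hG, hle⟩ := hg.dominated (|ξ| + 2 * A)
  have hab : ξ - A ≤ ξ + A := by linarith
  have hδ : ∀ᶠ δ : ℝ in 𝓝[>] 0, δ ∈ Set.Ioo 0 A := Ioo_mem_nhdsGT hA
  have hlim : Tendsto (fun δ : ℝ => ∫ x in (ξ - A)..(ξ + A), g (x + δ * Complex.I)) (𝓝[>] 0)
      (𝓝 (∫ x in (ξ - A)..(ξ + A), g x)) := by
    refine intervalIntegral.tendsto_integral_filter_of_dominated_convergence G ?_ ?_
      (hG.integrableOn_isCompact isCompact_uIcc).intervalIntegrable ?_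
    · filter_upwards [hδ] with δ h
      exact (continuous_comp_add_mul_I hg.differentiableOn h.1).aestronglyMeasurable
    · filter_upwards [hδ] with δ h
      filter_upwards [hle] with x hx hxm
      rw [Set.uIoc_of_le hab] at hxm
      exact hx δ h.1 (norm_ofReal_add_mul_I_le ⟨hxm.1.le, hxm.2⟩ ⟨h.1, h.2.le⟩)
    · filter_upwards [hg.tendsto] with x hx _ using hx
  refine le_of_tendsto hlim.norm ?_
  filter_upwards [hδ] with δ h
  exact norm_integral_line_le hg.differentiableOn ⟨h.1, h.2.le⟩ hM

theorem HasDominatedBoundary.tendsto_integral (hg : HasDominatedBoundary g)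
    (hz : Tendsto (fun z : ℂ => z * g z) (Bornology.cobounded ℂ ⊓ 𝓟 {z | 0 < z.im}) (𝓝 0))
    (ξ : ℝ) : Tendsto (fun A : ℝ => ∫ x in (ξ - A)..(ξ + A), g x) atTop (𝓝 0) := by
  rw [Metric.tendsto_nhds]
  intro ε hε
  -- For large `A`, the points at distance at least `A` from `ξ` satisfy `‖z‖ ≥ A / 2`, so `‖z g z‖
  -- < ε / 16` gives `‖g z‖ ≤ ε / (8 A)`. A contour of length at most `4 A` then contributes at most
  -- `ε / 2`.
  have h1 := Metric.tendsto_nhds.1 hz (ε / 16) (by positivity)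
  rw [eventually_inf_principal, ← comap_norm_atTop, eventually_comap] at h1
  obtain ⟨r, hr⟩ := eventually_atTop.1 h1
  filter_upwards [eventually_ge_atTop (2 * |ξ| + 1), eventually_ge_atTop (2 * r)] with A hA1 hA2
  have hA : 0 < A := by linarith [abs_nonneg ξ]
  have hM : ∀ z : ℂ, 0 < z.im → A ≤ ‖z - ξ‖ → ‖g z‖ ≤ ε / 8 / A := by
    intro z hz0 hzA
    have h2 : A / 2 ≤ ‖z‖ := by
      have := norm_sub_le z (ξ : ℂ)
      rw [Complex.norm_real, Real.norm_eq_abs] at this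
      linarith
    have h3 := hr ‖z‖ (by linarith) z rfl hz0
    rw [dist_zero_right, norm_mul] at h3
    rw [le_div_iff₀ hA]
    nlinarith [norm_nonneg (g z)]
  rw [dist_zero_right]
  refine (hg.norm_integral_le hA hM).trans_lt ?_
  rw [show 4 * A * (ε / 8 / A) = ε / 2 by field_simp; ring]
  linarith

end UpperHalfPlane

/-! ### Values, parity and size of `R` on the real line -/

theorem ofReal_cpow_half_of_nonneg {t : ℝ} (ht : 0 ≤ t) :
    (t : ℂ) ^ (1 / 2 : ℂ) = (Real.sqrt t : ℂ) := by
  rw [Real.sqrt_eq_rpow, Complex.ofReal_cpow ht]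
  norm_num

theorem ofReal_cpow_half_of_nonpos {t : ℝ} (ht : t ≤ 0) :
    (t : ℂ) ^ (1 / 2 : ℂ) = Complex.I * (Real.sqrt (-t) : ℂ) := by
  rw [Complex.ofReal_cpow_of_nonpos ht, ← Complex.ofReal_neg,
    ofReal_cpow_half_of_nonneg (by linarith), mul_comm,
    show (Real.pi : ℂ) * Complex.I * (1 / 2) = Real.pi / 2 * Complex.I by ring,
    Complex.exp_pi_div_two_mul_I]

theorem bandRoot_ofReal (a b x : ℝ) :
    bandRoot a b x = ((x - a : ℝ) : ℂ) * (((x - b) / (x - a) : ℝ) : ℂ) ^ (1 / 2 : ℂ) := by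
  simp [bandRoot]

theorem mul_sqrt_div {p q : ℝ} (hp : 0 < p) : p * Real.sqrt (q / p) = Real.sqrt (p * q) := by
  conv_lhs => rw [← Real.sqrt_sq hp.le, ← Real.sqrt_mul (sq_nonneg p)]
  congr 1
  rw [Real.sqrt_sq hp.le]
  field_simp

theorem bandRoot_of_ge {a b x : ℝ} (hab : a < b) (hx : b ≤ x) :
    bandRoot a b x = Real.sqrt ((x - a) * (x - b)) := by
  have h : 0 < x - a := by linarith
  rw [bandRoot_ofReal, ofReal_cpow_half_of_nonneg (div_nonneg (by linarith) h.le),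
    ← Complex.ofReal_mul, mul_sqrt_div h]

theorem bandRoot_of_le {a b x : ℝ} (hab : a < b) (hx : x ≤ a) :
    bandRoot a b x = -Real.sqrt ((a - x) * (b - x)) := by
  -- At `x = a` the prefactor `z - a` vanishes, so the default value of the quotient by zero does
  -- not matter.
  rcases hx.eq_or_lt with rfl | hx
  · simp [bandRoot]
  have h : 0 < a - x := by linarith
  have e : (x - b) / (x - a) = (b - x) / (a - x) := by
    rw [← neg_sub b x, ← neg_sub a x, neg_div_neg_eq]
  rw [bandRoot_ofReal, e, ofReal_cpow_half_of_nonneg (div_nonneg (by linarith) h.le),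
    ← Complex.ofReal_mul, ← neg_sub a x, neg_mul, mul_sqrt_div h]
  push_cast
  rfl

theorem bandRoot_of_mem {a b x : ℝ} (ha : a ≤ x) (hb : x ≤ b) :
    bandRoot a b x = Complex.I * Real.sqrt ((x - a) * (b - x)) := by
  rcases ha.eq_or_lt with rfl | ha
  · simp [bandRoot]
  have h : 0 < x - a := by linarith
  rw [bandRoot_ofReal,
    ofReal_cpow_half_of_nonpos (div_nonpos_of_nonpos_of_nonneg (by linarith) h.le),
    mul_left_comm, ← Complex.ofReal_mul, ← neg_div, neg_sub, mul_sqrt_div h]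

/-- The product of the branches belonging to the bands `[a, b]` and `[-b, -a]`. -/
noncomputable def pairRoot (a b : ℝ) (z : ℂ) : ℂ := bandRoot a b z * bandRoot (-b) (-a) z

theorem root_eq (N : ℕ) (lam : ℕ → ℝ) (z : ℂ) :
    root N lam z = bandRoot (-lam 1) (lam 1) z *
      ∏ k ∈ Finset.Icc 1 N, pairRoot (lam (2 * k)) (lam (2 * k + 1)) z := rfl

section pairRoot

variable {a b x : ℝ}

/-- Reflection interchanges the two bands. Between them the two factors have opposite signs, and
outside they have equal signs, so the product is real and even. On a band one factor is imaginary
and the other real; the real one changes sign under reflection, which makes the product odd there.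
These signs are what the positivity of `u` rests on. -/
theorem pairRoot_of_le (ha : 0 < a) (hab : a < b) (h0 : 0 ≤ x) (hx : x ≤ a) :
    ∃ r : ℝ, 0 ≤ r ∧ pairRoot a b x = -r ∧ pairRoot a b (-x : ℝ) = -r := by
  refine ⟨Real.sqrt ((a - x) * (b - x)) * Real.sqrt ((x + b) * (x + a)), by positivity, ?_, ?_⟩
  · rw [pairRoot, bandRoot_of_le hab hx, bandRoot_of_ge (by linarith) (by linarith)]
    simp
  · rw [pairRoot, bandRoot_of_le hab (by linarith), bandRoot_of_ge (by linarith) (by linarith)]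
    rw [show (a - -x) * (b - -x) = (x + b) * (x + a) by ring,
      show (-x - -b) * (-x - -a) = (a - x) * (b - x) by ring]
    push_cast
    ring

theorem pairRoot_of_ge (ha : 0 < a) (hab : a < b) (hx : b ≤ x) :
    ∃ r : ℝ, 0 ≤ r ∧ pairRoot a b x = r ∧ pairRoot a b (-x : ℝ) = r := by
  refine ⟨Real.sqrt ((x - a) * (x - b)) * Real.sqrt ((x + b) * (x + a)), by positivity, ?_, ?_⟩
  · rw [pairRoot, bandRoot_of_ge hab hx, bandRoot_of_ge (by linarith) (by linarith)]
    simp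
  · rw [pairRoot, bandRoot_of_le hab (by linarith), bandRoot_of_le (by linarith) (by linarith)]
    rw [show (a - -x) * (b - -x) = (x + b) * (x + a) by ring,
      show (-b - -x) * (-a - -x) = (x - a) * (x - b) by ring]
    push_cast
    ring

theorem pairRoot_of_mem (ha : 0 < a) (hx : a ≤ x) (hx' : x ≤ b) :
    ∃ r : ℝ, 0 ≤ r ∧ pairRoot a b x = Complex.I * r ∧
      pairRoot a b (-x : ℝ) = -(Complex.I * r) := by
  rcases (hx.trans hx').eq_or_lt with rfl | hab
  · obtain rfl : x = a := le_antisymm hx' hx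
    exact ⟨0, le_rfl, by simp [pairRoot, bandRoot], by simp [pairRoot, bandRoot]⟩
  refine ⟨Real.sqrt ((x - a) * (b - x)) * Real.sqrt ((x + b) * (x + a)), by positivity, ?_, ?_⟩
  · rw [pairRoot, bandRoot_of_mem hx hx', bandRoot_of_ge (by linarith) (by linarith)]
    push_cast
    ring_nf
  · rw [pairRoot, bandRoot_of_le hab (by linarith), bandRoot_of_mem (by linarith) (by linarith)]
    rw [show (a - -x) * (b - -x) = (x + b) * (x + a) by ring,
      show (-x - -b) * (-a - -x) = (x - a) * (b - x) by ring]
    push_cast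
    ring

theorem pairRoot_real (ha : 0 < a) (hab : a < b) (h0 : 0 ≤ x) (hx : x ≤ a ∨ b ≤ x) :
    ∃ r : ℝ, pairRoot a b x = r ∧ pairRoot a b (-x : ℝ) = r := by
  rcases hx with hx | hx
  · obtain ⟨r, -, h1, h2⟩ := pairRoot_of_le ha hab h0 hx
    exact ⟨-r, by simpa using h1, by rw [h2]; simp⟩
  · obtain ⟨r, -, h1, h2⟩ := pairRoot_of_ge ha hab hx
    exact ⟨r, h1, h2⟩

end pairRoot

theorem exists_prod_eq_ofReal {ι : Type*} {s : Finset ι} {F G : ι → ℂ}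
    (h : ∀ k ∈ s, ∃ r : ℝ, F k = r ∧ G k = r) :
    ∃ r : ℝ, ∏ k ∈ s, F k = r ∧ ∏ k ∈ s, G k = r := by
  choose! r h1 h2 using h
  refine ⟨∏ k ∈ s, r k, ?_, ?_⟩
  · rw [Finset.prod_congr rfl h1, Complex.ofReal_prod]
  · rw [Finset.prod_congr rfl h2, Complex.ofReal_prod]

theorem mem_bandsPos {N : ℕ} {lam : ℕ → ℝ} {x : ℝ} :
    x ∈ bandsPos N lam ↔ (0 ≤ x ∧ x ≤ lam 1) ∨
      ∃ k ∈ Finset.Icc 1 N, lam (2 * k) ≤ x ∧ x ≤ lam (2 * k + 1) := by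
  simp only [bandsPos, Set.mem_union, Set.mem_iUnion₂, Set.mem_Icc, exists_prop]

section root

variable {N : ℕ} {lam : ℕ → ℝ} {x : ℝ}

theorem lam_pos (hpos : 0 < lam 1) (hmono : StrictMonoOn lam (Set.Icc 1 (2 * N + 1))) {j : ℕ}
    (h1 : 1 ≤ j) (h2 : j ≤ 2 * N + 1) : 0 < lam j :=
  hpos.trans_le (hmono.monotoneOn ⟨le_rfl, by omega⟩ ⟨h1, h2⟩ h1)

theorem lam_le (hmono : StrictMonoOn lam (Set.Icc 1 (2 * N + 1))) {i j : ℕ}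
    (h1 : 1 ≤ i) (h : i ≤ j) (h2 : j ≤ 2 * N + 1) : lam i ≤ lam j :=
  hmono.monotoneOn ⟨h1, by omega⟩ ⟨by omega, h2⟩ h

theorem lam_lt (hmono : StrictMonoOn lam (Set.Icc 1 (2 * N + 1))) {i j : ℕ}
    (h1 : 1 ≤ i) (h : i < j) (h2 : j ≤ 2 * N + 1) : lam i < lam j :=
  hmono ⟨h1, by omega⟩ ⟨by omega, h2⟩ h

theorem nonneg_of_mem_bandsPos (hpos : 0 < lam 1)
    (hmono : StrictMonoOn lam (Set.Icc 1 (2 * N + 1))) (hx : x ∈ bandsPos N lam) : 0 ≤ x := by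
  rcases mem_bandsPos.1 hx with h | ⟨k, hk, h⟩
  · exact h.1
  · have := Finset.mem_Icc.1 hk
    exact (lam_pos hpos hmono (by omega) (by omega)).le.trans h.1

theorem le_of_mem_bandsPos (hmono : StrictMonoOn lam (Set.Icc 1 (2 * N + 1)))
    (hx : x ∈ bandsPos N lam) : x ≤ lam (2 * N + 1) := by
  rcases mem_bandsPos.1 hx with h | ⟨k, hk, h⟩
  · exact h.2.trans (lam_le hmono le_rfl (by omega) le_rfl)
  · have := Finset.mem_Icc.1 hk
    exact h.2.trans (lam_le hmono (by omega) (by omega) le_rfl)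

theorem mem_bands_iff_of_nonneg (hpos : 0 < lam 1)
    (hmono : StrictMonoOn lam (Set.Icc 1 (2 * N + 1))) (hx : 0 ≤ x) :
    x ∈ bands N lam ↔ x ∈ bandsPos N lam := by
  refine ⟨fun h => h.elim id fun h => ?_, Or.inl⟩
  have := nonneg_of_mem_bandsPos hpos hmono h
  obtain rfl : x = 0 := by linarith
  simpa using h

theorem neg_mem_bands_iff : -x ∈ bands N lam ↔ x ∈ bands N lam := by
  simp only [bands, Set.mem_union, Set.mem_ofPred_eq, neg_neg]
  exact or_comm

theorem off_band_of_mem_band (hmono : StrictMonoOn lam (Set.Icc 1 (2 * N + 1))) {k j : ℕ}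
    (hk : k ∈ Finset.Icc 1 N) (hj : j ∈ Finset.Icc 1 N) (hjk : j ≠ k)
    (hx : lam (2 * k) ≤ x ∧ x ≤ lam (2 * k + 1)) :
    x ≤ lam (2 * j) ∨ lam (2 * j + 1) ≤ x := by
  rw [Finset.mem_Icc] at hk hj
  rcases lt_or_gt_of_ne hjk with h | h
  · exact Or.inr ((lam_le hmono (by omega) (by omega) (by omega)).trans hx.1)
  · exact Or.inl (hx.2.trans (lam_le hmono (by omega) (by omega) (by omega)))

/-- Only the factor whose cut contains `x` is imaginary. On the central band that factor is even,
and so are all the pairs. On another band the central factor and the pair of that band are both odd,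
so the product is again even. Off the bands only the central factor is odd, so there `R` is odd. -/
theorem root_of_mem_bandsPos (hpos : 0 < lam 1)
    (hmono : StrictMonoOn lam (Set.Icc 1 (2 * N + 1))) (hx : x ∈ bandsPos N lam) :
    ∃ r : ℝ, root N lam x = Complex.I * r ∧ root N lam (-x : ℝ) = Complex.I * r := by
  have hx0 := nonneg_of_mem_bandsPos hpos hmono hx
  have hpair : ∀ k ∈ Finset.Icc 1 N, 0 < lam (2 * k) ∧ lam (2 * k) < lam (2 * k + 1) :=
    fun k hk => by
      have := Finset.mem_Icc.1 hk
      exact ⟨lam_pos hpos hmono (by omega) (by omega), lam_lt hmono (by omega) (by omega)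
        (by omega)⟩
  rcases mem_bandsPos.1 hx with h | ⟨k, hk, h⟩
  · obtain ⟨r, h1, h2⟩ := exists_prod_eq_ofReal (s := Finset.Icc 1 N)
      (F := fun k => pairRoot (lam (2 * k)) (lam (2 * k + 1)) x)
      (G := fun k => pairRoot (lam (2 * k)) (lam (2 * k + 1)) (-x : ℝ)) fun k hk =>
        pairRoot_real (hpair k hk).1 (hpair k hk).2 hx0 (Or.inl (h.2.trans (by
          have := Finset.mem_Icc.1 hk
          exact lam_le hmono le_rfl (by omega) (by omega))))
    refine ⟨Real.sqrt ((x - -lam 1) * (lam 1 - x)) * r, ?_, ?_⟩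
    · rw [root_eq, h1, bandRoot_of_mem (by linarith) (by linarith)]
      push_cast
      ring
    · rw [root_eq, h2, bandRoot_of_mem (by linarith) (by linarith),
        show (-x - -lam 1) * (lam 1 - -x) = (x - -lam 1) * (lam 1 - x) by ring]
      push_cast
      ring
  · obtain ⟨r, h1, h2⟩ := exists_prod_eq_ofReal (s := (Finset.Icc 1 N).erase k)
      (F := fun k => pairRoot (lam (2 * k)) (lam (2 * k + 1)) x)
      (G := fun k => pairRoot (lam (2 * k)) (lam (2 * k + 1)) (-x : ℝ)) fun j hj =>
        have hj' := Finset.mem_of_mem_erase hj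
        pairRoot_real (hpair j hj').1 (hpair j hj').2 hx0
          (off_band_of_mem_band hmono hk hj' (Finset.ne_of_mem_erase hj) h)
    obtain ⟨s, -, h3, h4⟩ := pairRoot_of_mem (hpair k hk).1 h.1 h.2
    have hk' := Finset.mem_Icc.1 hk
    have hx1 : lam 1 ≤ x := (lam_le hmono le_rfl (by omega) (by omega)).trans h.1
    refine ⟨Real.sqrt ((x - -lam 1) * (x - lam 1)) * s * r, ?_, ?_⟩
    · rw [root_eq, ← Finset.mul_prod_erase _ _ hk, h1, h3,
        bandRoot_of_ge (by linarith) (by linarith)]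
      push_cast
      ring
    · rw [root_eq, ← Finset.mul_prod_erase _ _ hk, h2, h4,
        bandRoot_of_le (by linarith) (by linarith),
        show (-lam 1 - -x) * (lam 1 - -x) = (x - -lam 1) * (x - lam 1) by ring]
      push_cast
      ring

theorem root_of_notMem_bandsPos (hpos : 0 < lam 1)
    (hmono : StrictMonoOn lam (Set.Icc 1 (2 * N + 1))) (hx0 : 0 ≤ x) (hx : x ∉ bandsPos N lam) :
    ∃ r : ℝ, root N lam x = r ∧ root N lam (-x : ℝ) = -r := by
  rw [mem_bandsPos] at hx
  push Not at hx
  obtain ⟨r, h1, h2⟩ := exists_prod_eq_ofReal (s := Finset.Icc 1 N)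
    (F := fun k => pairRoot (lam (2 * k)) (lam (2 * k + 1)) x)
    (G := fun k => pairRoot (lam (2 * k)) (lam (2 * k + 1)) (-x : ℝ)) fun k hk => by
      have hk' := Finset.mem_Icc.1 hk
      refine pairRoot_real (lam_pos hpos hmono (by omega) (by omega))
        (lam_lt hmono (by omega) (by omega) (by omega)) hx0 ?_
      by_contra! hcon
      exact (hx.2 k hk hcon.1.le).not_ge hcon.2.le
  have hx1 := hx.1 hx0
  refine ⟨Real.sqrt ((x - -lam 1) * (x - lam 1)) * r, ?_, ?_⟩
  · rw [root_eq, h1, bandRoot_of_ge (by linarith) (by linarith)]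
    push_cast
    ring
  · rw [root_eq, h2, bandRoot_of_le (by linarith) (by linarith),
      show (-lam 1 - -x) * (lam 1 - -x) = (x - -lam 1) * (x - lam 1) by ring]
    push_cast
    ring

theorem root_of_mem_bands (hpos : 0 < lam 1) (hmono : StrictMonoOn lam (Set.Icc 1 (2 * N + 1)))
    (hx : x ∈ bands N lam) :
    ∃ r : ℝ, root N lam x = Complex.I * r ∧ root N lam (-x : ℝ) = Complex.I * r := by
  rcases hx with hx | hx
  · exact root_of_mem_bandsPos hpos hmono hx
  · obtain ⟨r, h1, h2⟩ := root_of_mem_bandsPos hpos hmono hx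
    exact ⟨r, by simpa using h2, h1⟩

theorem root_of_notMem_bands (hpos : 0 < lam 1)
    (hmono : StrictMonoOn lam (Set.Icc 1 (2 * N + 1))) (hx : x ∉ bands N lam) :
    ∃ r : ℝ, root N lam x = r ∧ root N lam (-x : ℝ) = -r := by
  rcases le_total 0 x with h | h
  · exact root_of_notMem_bandsPos hpos hmono h fun h' => hx (Or.inl h')
  · obtain ⟨r, h1, h2⟩ := root_of_notMem_bandsPos hpos hmono (neg_nonneg.2 h)
      fun h' => hx (Or.inr h')
    exact ⟨-r, by simpa using h2, by rw [h1]; simp⟩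

theorem root_ne_zero {z : ℂ} (hz : ∀ y ∈ branchPoints N lam, z ≠ y) : root N lam z ≠ 0 := by
  rw [← pow_ne_zero_iff two_ne_zero, root_sq, Finset.prod_ne_zero_iff]
  intro j hj h
  rw [sq_sub_sq, mul_eq_zero] at h
  rcases h with h | h
  · exact hz (-lam j) ⟨j, hj, Or.inr rfl⟩ (by push_cast; linear_combination h)
  · exact hz (lam j) ⟨j, hj, Or.inl rfl⟩ (by linear_combination h)

theorem root_ofReal_ne_zero (hx : x ∉ branchPoints N lam) : root N lam x ≠ 0 :=
  root_ne_zero fun y hy h => hx (by rwa [Complex.ofReal_inj.1 h])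

theorem root_ne_zero_of_im_pos {z : ℂ} (hz : 0 < z.im) : root N lam z ≠ 0 :=
  root_ne_zero fun y _ h => by simp [h] at hz

theorem differentiableOn_root (hpos : 0 < lam 1)
    (hmono : StrictMonoOn lam (Set.Icc 1 (2 * N + 1))) :
    DifferentiableOn ℂ (root N lam) {z | 0 < z.im} := fun z hz =>
  (differentiableAt_root hpos hmono fun y _ h => by
    have : 0 < z.im := hz
    simp [h] at this).differentiableWithinAt

theorem norm_sq_root (z : ℂ) : ‖root N lam z‖ ^ 2 =
    ∏ j ∈ Finset.Icc 1 (2 * N + 1), (‖z - lam j‖ * ‖z + lam j‖) := by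
  rw [← norm_pow, root_sq, norm_prod]
  refine Finset.prod_congr rfl fun j _ => ?_
  rw [← norm_mul]
  ring_nf

/-- The branch points are real, so moving vertically off the real line increases the distance to
each of them. Hence `1 / |R|` on the line dominates `1 / |R|` above it. -/
theorem norm_root_le (x δ : ℝ) :
    ‖root N lam x‖ ≤ ‖root N lam (x + δ * Complex.I)‖ := by
  rw [← sq_le_sq₀ (norm_nonneg _) (norm_nonneg _), norm_sq_root, norm_sq_root]
  have key : ∀ c : ℝ, ‖(x : ℂ) + c‖ ≤ ‖(x : ℂ) + δ * Complex.I + c‖ := fun c => by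
    refine le_trans ?_ (Complex.abs_re_le_norm _)
    rw [← Complex.ofReal_add, Complex.norm_real]
    simp
  refine Finset.prod_le_prod (fun _ _ => by positivity) fun j _ => ?_
  refine mul_le_mul ?_ (key _) (norm_nonneg _) (norm_nonneg _)
  simpa [sub_eq_add_neg] using key (-lam j)

theorem finite_branchPoints : (branchPoints N lam).Finite := by
  have : branchPoints N lam ⊆
      ((Finset.Icc 1 (2 * N + 1)).image lam ∪ (Finset.Icc 1 (2 * N + 1)).image (fun j => -lam j) :
        Finset ℝ) := by
    rintro x ⟨j, hj, rfl | rfl⟩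
    · exact Finset.mem_union_left _ (Finset.mem_image_of_mem _ hj)
    · exact Finset.mem_union_right _ (Finset.mem_image_of_mem (fun j => -lam j) hj)
  exact (Finset.finite_toSet _).subset this

theorem ae_notMem_branchPoints : ∀ᵐ x : ℝ, x ∉ branchPoints N lam :=
  (finite_branchPoints.measure_zero volume : volume (branchPoints N lam) = 0) |>
    measure_eq_zero_iff_ae_notMem.1

/-- The `4 N + 2` branch points are distinct, and `|R|²` is the product of the distances to them. So
`|R| ^ α` has singularities of order `α / 2` only. -/
theorem locallyIntegrable_norm_root_rpow (hpos : 0 < lam 1)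
    (hmono : StrictMonoOn lam (Set.Icc 1 (2 * N + 1))) {α : ℝ} (hα : -2 < α) :
    LocallyIntegrable fun x : ℝ => ‖root N lam x‖ ^ α := by
  have hinj : Set.InjOn lam (Finset.Icc 1 (2 * N + 1) : Finset ℕ) := by
    simpa using hmono.injOn
  refine (locallyIntegrable_prod_abs_sub_rpow
    ((Finset.Icc 1 (2 * N + 1)).image lam ∪ (Finset.Icc 1 (2 * N + 1)).image (fun j => -lam j))
    (show -1 < α / 2 by linarith)).congr (Eventually.of_forall fun x => ?_)
  have hdisj : Disjoint ((Finset.Icc 1 (2 * N + 1)).image lam)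
      ((Finset.Icc 1 (2 * N + 1)).image (fun j => -lam j)) := by
    rw [Finset.disjoint_left]
    intro y hy hy'
    obtain ⟨i, hi, rfl⟩ := Finset.mem_image.1 hy
    obtain ⟨j, hj, h⟩ := Finset.mem_image.1 hy'
    rw [Finset.mem_Icc] at hi hj
    linarith [lam_pos hpos hmono hi.1 hi.2, lam_pos hpos hmono hj.1 hj.2]
  have h2 : ‖root N lam x‖ ^ α = (‖root N lam x‖ ^ 2) ^ (α / 2) := by
    rw [← Real.rpow_natCast, ← Real.rpow_mul (norm_nonneg _)]
    congr 1
    push_cast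
    ring
  simp only
  rw [h2, norm_sq_root, Finset.prod_union hdisj, Finset.prod_image hinj,
    Finset.prod_image fun i hi j hj h => hinj hi hj (neg_injective h), ← Finset.prod_mul_distrib,
    ← Real.finsetProd_rpow _ _ fun _ _ => by positivity]
  refine Finset.prod_congr rfl fun j _ => ?_
  rw [Real.mul_rpow (norm_nonneg _) (norm_nonneg _), ← Complex.ofReal_sub, ← Complex.ofReal_add,
    Complex.norm_real, Complex.norm_real, Real.norm_eq_abs, Real.norm_eq_abs, sub_neg_eq_add]

end root

/-! ### The differential `i S / R` and its residual near the real line -/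

/-- The density `i S(z) / R(z)` of a differential with a real numerator `S`. -/
noncomputable def density (N : ℕ) (lam : ℕ → ℝ) (S : ℝ[X]) (z : ℂ) : ℂ :=
  Complex.I * aeval z S / root N lam z

/-- The difference between `i S(z) / R(z)` and its polynomial part `i T(z)` at infinity. -/
noncomputable def residual (N : ℕ) (lam : ℕ → ℝ) (S T : ℝ[X]) (z : ℂ) : ℂ :=
  density N lam S z - Complex.I * aeval z T

theorem aeval_ofReal_complex (S : ℝ[X]) (x : ℝ) : aeval (x : ℂ) S = ((S.eval x : ℝ) : ℂ) := by
  rw [← Complex.coe_algebraMap, aeval_algebraMap_apply]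
  simp

/-- Divide `F² - c²` by `F + c`, which tends to `2 c ≠ 0`. This gives a one-sided Lipschitz estimate
for `1 / R` on the cut, where `R` jumps but its square is a polynomial. -/
theorem isBigO_sub_of_isBigO_sq_sub {l : Filter ℂ} {F : ℂ → ℂ} {ξ c : ℂ} (hc : c ≠ 0)
    (hF : Tendsto F l (𝓝 c)) (h : (fun z => F z ^ 2 - c ^ 2) =O[l] fun z => z - ξ) :
    (fun z => F z - c) =O[l] fun z => z - ξ := by
  have hne : c + c ≠ 0 := by simpa [← two_mul] using hc
  have h1 : Tendsto (fun z => (F z + c)⁻¹) l (𝓝 (c + c)⁻¹) := (hF.add_const c).inv₀ hne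
  have h2 := h.mul (h1.isBigO_one ℂ)
  simp only [mul_one] at h2
  refine h2.congr' ?_ EventuallyEq.rfl
  filter_upwards [(hF.add_const c).eventually_ne hne] with z hz
  field_simp
  ring

theorem isBigO_mul_sub {l : Filter ℂ} {F G : ℂ → ℂ} {ξ c d : ℂ} (hF : Tendsto F l (𝓝 c))
    (hF' : (fun z => F z - c) =O[l] fun z => z - ξ)
    (hG' : (fun z => G z - d) =O[l] fun z => z - ξ) :
    (fun z => F z * G z - c * d) =O[l] fun z => z - ξ := by
  have h1 := (hF.isBigO_one ℂ).mul hG'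
  simp only [one_mul] at h1
  refine (h1.add (hF'.const_mul_left d)).congr_left fun z => ?_
  ring

section

variable {N : ℕ} {lam : ℕ → ℝ} {S T : ℝ[X]} {x ξ : ℝ}

theorem density_im_of_mem (hpos : 0 < lam 1) (hmono : StrictMonoOn lam (Set.Icc 1 (2 * N + 1)))
    (S : ℝ[X]) (hx : x ∈ bands N lam) : (density N lam S x).im = 0 := by
  obtain ⟨r, hr, -⟩ := root_of_mem_bands hpos hmono hx
  rw [density, aeval_ofReal_complex, hr, mul_div_mul_left _ _ Complex.I_ne_zero,
    ← Complex.ofReal_div, Complex.ofReal_im]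

theorem density_re_of_notMem (hpos : 0 < lam 1)
    (hmono : StrictMonoOn lam (Set.Icc 1 (2 * N + 1))) (S : ℝ[X]) (hx : x ∉ bands N lam) :
    (density N lam S x).re = 0 := by
  obtain ⟨r, hr, -⟩ := root_of_notMem_bands hpos hmono hx
  rw [density, aeval_ofReal_complex, hr, mul_div_assoc, ← Complex.ofReal_div]
  simp

theorem density_neg_of_mem (hpos : 0 < lam 1) (hmono : StrictMonoOn lam (Set.Icc 1 (2 * N + 1)))
    (hS : S.comp (-X) = -S) (hx : x ∈ bands N lam) :
    density N lam S (-x : ℝ) = -density N lam S x := by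
  obtain ⟨r, hr, hr'⟩ := root_of_mem_bands hpos hmono hx
  have := congrArg (eval x) hS
  simp only [eval_comp, eval_neg, eval_X] at this
  rw [density, density, aeval_ofReal_complex, aeval_ofReal_complex, hr, hr', this]
  push_cast
  ring

theorem density_neg_of_notMem (hpos : 0 < lam 1)
    (hmono : StrictMonoOn lam (Set.Icc 1 (2 * N + 1)))
    (hS : S.comp (-X) = -S) (hx : x ∉ bands N lam) :
    density N lam S (-x : ℝ) = density N lam S x := by
  obtain ⟨r, hr, hr'⟩ := root_of_notMem_bands hpos hmono hx
  have := congrArg (eval x) hS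
  simp only [eval_comp, eval_neg, eval_X] at this
  rw [density, density, aeval_ofReal_complex, aeval_ofReal_complex, hr, hr', this]
  push_cast
  rw [mul_neg, neg_div_neg_eq]

theorem differentiableOn_density (hpos : 0 < lam 1)
    (hmono : StrictMonoOn lam (Set.Icc 1 (2 * N + 1))) (S : ℝ[X]) :
    DifferentiableOn ℂ (density N lam S) {z | 0 < z.im} :=
  ((S.differentiable_aeval.differentiableOn).const_mul _).div (differentiableOn_root hpos hmono)
    fun _ hz => root_ne_zero_of_im_pos hz

theorem differentiableOn_residual (hpos : 0 < lam 1)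
    (hmono : StrictMonoOn lam (Set.Icc 1 (2 * N + 1))) (S T : ℝ[X]) :
    DifferentiableOn ℂ (residual N lam S T) {z | 0 < z.im} :=
  (differentiableOn_density hpos hmono S).sub
    ((T.differentiable_aeval.differentiableOn).const_mul _)

theorem exists_norm_aeval_le (S : ℝ[X]) (B : ℝ) :
    ∃ C : ℝ, 0 ≤ C ∧ ∀ z : ℂ, ‖z‖ ≤ B → ‖aeval z S‖ ≤ C := by
  obtain ⟨C, hC⟩ := (isCompact_closedBall (0 : ℂ) B).exists_bound_of_continuousOn
    (f := fun z => aeval z S) S.continuous_aeval.continuousOn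
  exact ⟨max C 0, le_max_right _ _, fun z hz => (hC z (by simpa using hz)).trans (le_max_left _ _)⟩

theorem exists_norm_residual_le (N : ℕ) (lam : ℕ → ℝ) (S T : ℝ[X]) (B : ℝ) :
    ∃ C : ℝ, 0 ≤ C ∧ ∀ x : ℝ, x ∉ branchPoints N lam → ∀ δ : ℝ, ‖(x + δ * Complex.I : ℂ)‖ ≤ B →
      ‖residual N lam S T (x + δ * Complex.I)‖ ≤ C * (‖root N lam x‖⁻¹ + 1) := by
  obtain ⟨C₁, h₁, hS⟩ := exists_norm_aeval_le S B
  obtain ⟨C₂, h₂, hT⟩ := exists_norm_aeval_le T B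
  refine ⟨C₁ + C₂, by positivity, fun x hx δ hz => ?_⟩
  have hR : 0 < ‖root N lam x‖ := norm_pos_iff.2 (root_ofReal_ne_zero hx)
  have hS' := hS _ hz
  have hT' := hT _ hz
  have e1 : ‖density N lam S (x + δ * Complex.I)‖ ≤ C₁ * ‖root N lam x‖⁻¹ := by
    rw [density, norm_div, norm_mul, Complex.norm_I, one_mul, div_eq_mul_inv]
    gcongr
    exact norm_root_le x δ
  refine (norm_sub_le _ _).trans ?_
  rw [norm_mul, Complex.norm_I, one_mul]
  have : 0 ≤ ‖root N lam x‖⁻¹ := by positivity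
  nlinarith

theorem locallyIntegrable_inv_norm_root (hpos : 0 < lam 1)
    (hmono : StrictMonoOn lam (Set.Icc 1 (2 * N + 1))) :
    LocallyIntegrable fun x : ℝ => ‖root N lam x‖⁻¹ := by
  simpa [Real.rpow_neg_one] using
    locallyIntegrable_norm_root_rpow hpos hmono (show (-2 : ℝ) < -1 by norm_num)

theorem tendsto_density (S : ℝ[X]) {l : Filter ℂ} (hl : l ≤ 𝓝 (x : ℂ))
    (hroot : Tendsto (root N lam) l (𝓝 (root N lam x))) (hx : x ∉ branchPoints N lam) :
    Tendsto (density N lam S) l (𝓝 (density N lam S x)) :=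
  (((S.continuous_aeval.tendsto _).mono_left hl).const_mul _).div hroot (root_ofReal_ne_zero hx)

theorem tendsto_add_mul_I (x : ℝ) :
    Tendsto (fun δ : ℝ => (x : ℂ) + δ * Complex.I) (𝓝[>] 0) (𝓝[{z | 0 < z.im}] (x : ℂ)) := by
  refine tendsto_nhdsWithin_iff.2 ⟨?_, ?_⟩
  · have : Tendsto (fun δ : ℝ => (x : ℂ) + δ * Complex.I) (𝓝 0) (𝓝 (x + (0 : ℝ) * Complex.I)) :=
      (by fun_prop : Continuous fun δ : ℝ => (x : ℂ) + δ * Complex.I).tendsto 0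
    simp only [Complex.ofReal_zero, zero_mul, add_zero] at this
    exact this.mono_left nhdsWithin_le_nhds
  · filter_upwards [self_mem_nhdsWithin] with δ hδ
    simpa using hδ

theorem tendsto_residual_upper (hpos : 0 < lam 1)
    (hmono : StrictMonoOn lam (Set.Icc 1 (2 * N + 1))) (S T : ℝ[X])
    (hx : x ∉ branchPoints N lam) :
    Tendsto (residual N lam S T) (𝓝[{z | 0 < z.im}] (x : ℂ)) (𝓝 (residual N lam S T x)) :=
  (tendsto_density S nhdsWithin_le_nhds (tendsto_root_upper hpos hmono hx) hx).sub
    (((T.continuous_aeval.tendsto _).mono_left nhdsWithin_le_nhds).const_mul _)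

theorem hasDominatedBoundary_residual (hpos : 0 < lam 1)
    (hmono : StrictMonoOn lam (Set.Icc 1 (2 * N + 1))) (S T : ℝ[X]) :
    HasDominatedBoundary (residual N lam S T) where
  differentiableOn := differentiableOn_residual hpos hmono S T
  dominated B := by
    obtain ⟨C, -, hC⟩ := exists_norm_residual_le N lam S T B
    refine ⟨fun x => C * (‖root N lam x‖⁻¹ + 1),
      ((locallyIntegrable_inv_norm_root hpos hmono).add (locallyIntegrable_const 1)).smul C, ?_⟩
    filter_upwards [ae_notMem_branchPoints (N := N) (lam := lam)] with x hx δ _ hB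
    exact hC x hx δ hB
  tendsto := by
    filter_upwards [ae_notMem_branchPoints (N := N) (lam := lam)] with x hx
    exact (tendsto_residual_upper hpos hmono S T hx).comp (tendsto_add_mul_I x)

theorem locallyIntegrable_density (hpos : 0 < lam 1)
    (hmono : StrictMonoOn lam (Set.Icc 1 (2 * N + 1))) (S : ℝ[X]) :
    LocallyIntegrable fun x : ℝ => density N lam S x := by
  simpa [residual] using (hasDominatedBoundary_residual hpos hmono S 0).locallyIntegrable

theorem isBigO_residual_sub (hpos : 0 < lam 1)
    (hmono : StrictMonoOn lam (Set.Icc 1 (2 * N + 1))) (S T : ℝ[X])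
    (hx : x ∉ branchPoints N lam) :
    (fun z => residual N lam S T z - residual N lam S T x) =O[𝓝[{z | 0 < z.im}] (x : ℂ)]
      fun z => z - x := by
  have hpoly : ∀ S : ℝ[X], (fun z : ℂ => aeval z S - aeval (x : ℂ) S)
      =O[𝓝[{z | 0 < z.im}] (x : ℂ)] fun z => z - x := fun S =>
    (S.differentiable_aeval (x : ℂ)).isBigO_sub.mono nhdsWithin_le_nhds
  have hR := root_ofReal_ne_zero hx
  have hroot := tendsto_root_upper hpos hmono hx
  have hinv : (fun z => (root N lam z)⁻¹ - (root N lam x)⁻¹)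
      =O[𝓝[{z | 0 < z.im}] (x : ℂ)] fun z => z - x := by
    refine isBigO_sub_of_isBigO_sq_sub (inv_ne_zero hR) (hroot.inv₀ hR) ?_
    -- Unlike `1 / R`, its square is a rational function, holomorphic on both sides of the cut near
    -- `x`.
    have hd : DifferentiableAt ℂ (fun z : ℂ => (root N lam z ^ 2)⁻¹) x := by
      refine DifferentiableAt.inv ?_ (pow_ne_zero 2 hR)
      simp_rw [root_sq]
      fun_prop
    simpa only [inv_pow] using hd.isBigO_sub.mono nhdsWithin_le_nhds
  have hmul := isBigO_mul_sub (((S.continuous_aeval.tendsto (x : ℂ)).mono_left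
    nhdsWithin_le_nhds)) (hpoly S) hinv
  refine ((hmul.const_mul_left Complex.I).sub ((hpoly T).const_mul_left Complex.I)).congr_left
    fun z => ?_
  simp only [residual, density]
  ring

end

/-! ### The Hilbert transform -/

section

variable {N : ℕ} {lam : ℕ → ℝ} {S T : ℝ[X]} {ξ : ℝ}

/-- The residual with its value at `ξ` removed, divided by `z - ξ`. Subtracting a multiple of
`i / (z - ξ + i)` instead of a constant keeps the decay at infinity. -/
noncomputable def residualQuotient (N : ℕ) (lam : ℕ → ℝ) (S T : ℝ[X]) (ξ : ℝ) (z : ℂ) : ℂ :=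
  (residual N lam S T z - residual N lam S T ξ * (Complex.I / (z - ξ + Complex.I))) / (z - ξ)

theorem add_I_ne_zero_of_im_nonneg {z : ℂ} (hz : 0 ≤ z.im) : z - ξ + Complex.I ≠ 0 := fun h => by
  have := congrArg Complex.im h
  simp at this
  linarith

theorem sub_ofReal_ne_zero_of_im_pos {z : ℂ} (hz : 0 < z.im) : z - ξ ≠ 0 := fun h => by
  have := congrArg Complex.im h
  simp at this
  linarith

theorem norm_I_div_le_one {z : ℂ} (hz : 0 ≤ z.im) : ‖Complex.I / (z - ξ + Complex.I)‖ ≤ 1 := by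
  rw [norm_div, Complex.norm_I]
  refine div_le_one_of_le₀ (le_trans ?_ (Complex.abs_im_le_norm _)) (norm_nonneg _)
  simpa using (by linarith : 1 ≤ z.im + 1).trans (le_abs_self _)

theorem hasDominatedBoundary_residualQuotient (hpos : 0 < lam 1)
    (hmono : StrictMonoOn lam (Set.Icc 1 (2 * N + 1))) (S T : ℝ[X])
    (hξ : ξ ∉ branchPoints N lam) :
    HasDominatedBoundary (residualQuotient N lam S T ξ) where
  differentiableOn := by
    have hid : DifferentiableOn ℂ (fun z : ℂ => z - ξ) {z | 0 < z.im} :=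
      (differentiable_id.sub_const _).differentiableOn
    refine ((differentiableOn_residual hpos hmono S T).sub
      (((differentiableOn_const _).div (hid.add_const _) fun z hz => ?_).const_mul _)).div hid
      fun z hz => sub_ofReal_ne_zero_of_im_pos hz
    exact add_I_ne_zero_of_im_nonneg (le_of_lt hz)
  dominated B := by
    obtain ⟨C, hC0, hC⟩ := exists_norm_residual_le N lam S T B
    -- The correction factor `i / (z - ξ + i)` equals `1` at `ξ`, so the numerator of the quotient
    -- vanishes to first order at `ξ`.
    have hφ : (fun z : ℂ => residual N lam S T ξ * (1 - Complex.I / (z - ξ + Complex.I)))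
        =O[𝓝[{z | 0 < z.im}] (ξ : ℂ)] fun z => z - ξ := by
      have hd : DifferentiableAt ℂ (fun z : ℂ => 1 - Complex.I / (z - ξ + Complex.I)) ξ := by
        refine (differentiableAt_const _).sub ((differentiableAt_const _).div (by fun_prop) ?_)
        simp
      have := hd.isBigO_sub.mono (nhdsWithin_le_nhds (s := {z | 0 < z.im}))
      simpa using this.const_mul_left (residual N lam S T ξ)
    have hO := (isBigO_residual_sub hpos hmono S T hξ).add hφ
    obtain ⟨L, hL0, hL⟩ := hO.exists_nonneg
    rw [isBigOWith_iff, eventually_nhdsWithin_iff, Metric.eventually_nhds_iff] at hL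
    obtain ⟨r, hr, hL⟩ := hL
    -- The constant `L` bounds the quotient within distance `r` of `ξ`; the second term bounds it at
    -- distance at least `r`, where `1 / |z - ξ| ≤ 1 / r`.
    refine ⟨fun x => L + (C * (‖root N lam x‖⁻¹ + 1) + ‖residual N lam S T ξ‖) * r⁻¹, ?_, ?_⟩
    · exact (locallyIntegrable_const L).add
        ((((((locallyIntegrable_inv_norm_root hpos hmono).add (locallyIntegrable_const 1)).smul C
          ).add (locallyIntegrable_const _)).mul_continuous continuous_const))
    · filter_upwards [ae_notMem_branchPoints (N := N) (lam := lam)] with x hx δ hδ hB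
      have him : 0 < ((x : ℂ) + δ * Complex.I).im := by simpa using hδ
      set z : ℂ := x + δ * Complex.I with hz
      have hne : z - ξ ≠ 0 := sub_ofReal_ne_zero_of_im_pos him
      have hpos' : 0 < ‖z - ξ‖ := norm_pos_iff.2 hne
      have hRnn : 0 ≤ ‖root N lam x‖⁻¹ := by positivity
      have hCx := hC x hx δ hB
      rw [residualQuotient, norm_div, div_le_iff₀ hpos']
      rcases lt_or_ge ‖z - ξ‖ r with h | h
      · have h1 := hL (by rwa [dist_eq_norm]) him
        have e : residual N lam S T z - residual N lam S T ξ +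
            residual N lam S T ξ * (1 - Complex.I / (z - ξ + Complex.I)) =
            residual N lam S T z - residual N lam S T ξ *
              (Complex.I / (z - ξ + Complex.I)) := by ring
        rw [e] at h1
        refine h1.trans (mul_le_mul_of_nonneg_right ?_ hpos'.le)
        have : 0 ≤ (C * (‖root N lam x‖⁻¹ + 1) + ‖residual N lam S T ξ‖) * r⁻¹ := by positivity
        linarith
      · have h1 : ‖residual N lam S T z - residual N lam S T ξ *
            (Complex.I / (z - ξ + Complex.I))‖ ≤
            C * (‖root N lam x‖⁻¹ + 1) + ‖residual N lam S T ξ‖ := by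
          refine (norm_sub_le _ _).trans (add_le_add hCx ?_)
          rw [norm_mul]
          exact mul_le_of_le_one_right (norm_nonneg _) (norm_I_div_le_one him.le)
        have h2 : 1 ≤ r⁻¹ * ‖z - ξ‖ := by
          rw [inv_mul_eq_div, one_le_div hr]
          exact h
        have h3 : 0 ≤ C * (‖root N lam x‖⁻¹ + 1) + ‖residual N lam S T ξ‖ := by positivity
        have h4 := mul_le_mul_of_nonneg_left h2 h3
        have h5 : 0 ≤ L * ‖z - ξ‖ := by positivity
        calc _ ≤ _ := h1
          _ ≤ (C * (‖root N lam x‖⁻¹ + 1) + ‖residual N lam S T ξ‖) * (r⁻¹ * ‖z - ξ‖) := by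
            linarith
          _ ≤ _ := by rw [add_mul, mul_assoc]; linarith
  tendsto := by
    filter_upwards [ae_notMem_branchPoints (N := N) (lam := lam),
      (measure_eq_zero_iff_ae_notMem.1 (Real.volume_singleton (a := ξ)))] with x hx hxξ
    have hne : (x : ℂ) - ξ ≠ 0 := by
      rw [sub_ne_zero]
      exact_mod_cast hxξ
    have hid : Tendsto (fun z : ℂ => z - ξ) (𝓝[{z | 0 < z.im}] (x : ℂ)) (𝓝 ((x : ℂ) - ξ)) :=
      (tendsto_id.mono_left nhdsWithin_le_nhds).sub_const _
    exact (((tendsto_residual_upper hpos hmono S T hx).sub ((tendsto_const_nhds.div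
      (hid.add_const _) (add_I_ne_zero_of_im_nonneg (by simp))).const_mul _)).div hid hne).comp
      (tendsto_add_mul_I x)

theorem tendsto_sub_const_cobounded (c : ℂ) :
    Tendsto (fun z : ℂ => z - c) (Bornology.cobounded ℂ) (Bornology.cobounded ℂ) := by
  rw [← tendsto_norm_atTop_iff_cobounded]
  refine tendsto_atTop_mono (fun z => norm_sub_norm_le z c) ?_
  exact tendsto_atTop_add_const_right _ (-‖c‖) tendsto_norm_cobounded_atTop

theorem tendsto_mul_residualQuotient
    (hT : Tendsto (residual N lam S T) (Bornology.cobounded ℂ) (𝓝 0)) (ξ : ℝ) :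
    Tendsto (fun z => z * residualQuotient N lam S T ξ z) (Bornology.cobounded ℂ) (𝓝 0) := by
  have h1 : Tendsto (fun z : ℂ => z - ξ) (Bornology.cobounded ℂ) (Bornology.cobounded ℂ) :=
    tendsto_sub_const_cobounded _
  have h2 : Tendsto (fun z : ℂ => Complex.I / (z - ξ + Complex.I)) (Bornology.cobounded ℂ)
      (𝓝 0) := by
    have h := tendsto_inv₀_cobounded.comp (tendsto_sub_const_cobounded (ξ - Complex.I))
    have := h.const_mul Complex.I
    rw [mul_zero] at this
    refine this.congr fun z => ?_
    rw [Function.comp_apply, div_eq_mul_inv]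
    congr 2
    ring
  have h3 : Tendsto (fun z : ℂ => 1 + ξ * (z - ξ)⁻¹) (Bornology.cobounded ℂ) (𝓝 1) := by
    simpa using ((tendsto_inv₀_cobounded.comp h1).const_mul (ξ : ℂ)).const_add 1
  have h4 := (hT.sub (h2.const_mul (residual N lam S T ξ))).mul h3
  simp only [mul_zero, sub_zero, zero_mul] at h4
  refine h4.congr' ?_
  filter_upwards [Bornology.eventually_ne_cobounded (ξ : ℂ)] with z hz
  have : z - ξ ≠ 0 := sub_ne_zero.2 hz
  rw [residualQuotient]
  field_simp
  ring

/-- For real `t`, `i / (t + i) = (1 + i t) / (1 + t²)`. The even part multiplies the real number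
`density ξ`, and after division by `t = ±s` it cancels in the sum. The odd part multiplies `Im
residual ξ = -T(ξ)` and leaves `2 T(ξ) / (1 + s²)`, the source of the arctangent below. -/
theorem re_residualQuotient_add {s : ℝ} (hs : 0 < s) (hξ : (density N lam S ξ).im = 0) :
    (residualQuotient N lam S T ξ (ξ + s : ℝ)).re + (residualQuotient N lam S T ξ (ξ - s : ℝ)).re =
      (density N lam S (ξ + s : ℝ)).re / s - (density N lam S (ξ - s : ℝ)).re / s -
        2 * T.eval ξ * (1 + s ^ 2)⁻¹ := by
  have hs2 : (s : ℂ) ^ 2 + 1 ≠ 0 := by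
    norm_cast
    positivity
  have hI : ∀ t : ℝ, t ^ 2 = s ^ 2 → Complex.I / ((t : ℂ) + Complex.I) =
      ((s ^ 2 + 1)⁻¹ : ℝ) * (1 + Complex.I * t) := fun t ht => by
    have ht' : (t : ℂ) ^ 2 = (s : ℂ) ^ 2 := by exact_mod_cast ht
    have hne : (t : ℂ) + Complex.I ≠ 0 := fun h => by simpa using congrArg Complex.im h
    push_cast
    rw [div_eq_iff hne, mul_assoc, eq_inv_mul_iff_mul_eq₀ hs2, ← ht']
    linear_combination (-(t : ℂ)) * Complex.I_sq
  obtain ⟨u, hd⟩ : ∃ u : ℝ, density N lam S ξ = u :=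
    ⟨(density N lam S ξ).re, Complex.ext rfl (by simpa using hξ)⟩
  have hres : ∀ t : ℝ, t ^ 2 = s ^ 2 → (residualQuotient N lam S T ξ (ξ + t : ℝ)).re =
      ((density N lam S (ξ + t : ℝ)).re -
        (u + T.eval ξ * t) * (s ^ 2 + 1)⁻¹) / t := fun t ht => by
    have e : ((ξ + t : ℝ) : ℂ) - ξ = (t : ℂ) := by push_cast; ring
    rw [residualQuotient, e, hI t ht, Complex.div_ofReal_re]
    congr 1
    rw [residual, residual, hd, aeval_ofReal_complex, aeval_ofReal_complex]
    simp only [Complex.sub_re, Complex.sub_im, Complex.mul_re, Complex.mul_im, Complex.I_re,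
      Complex.I_im, Complex.ofReal_re, Complex.ofReal_im, Complex.add_re, Complex.add_im,
      Complex.one_re, Complex.one_im]
    ring
  have h1 := hres s rfl
  have h2 := hres (-s) (by ring)
  rw [← sub_eq_add_neg] at h2
  rw [h1, h2]
  have : s ^ 2 + 1 ≠ 0 := by positivity
  rw [add_comm 1 (s ^ 2)]
  field_simp
  ring

theorem measurableSet_bands : MeasurableSet (bands N lam) := by
  have h : MeasurableSet (bandsPos N lam) :=
    measurableSet_Icc.union (Finset.measurableSet_biUnion _ fun _ _ => measurableSet_Icc)
  exact h.union (h.preimage measurable_neg)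

theorem bands_subset_Icc (hpos : 0 < lam 1) (hmono : StrictMonoOn lam (Set.Icc 1 (2 * N + 1))) :
    bands N lam ⊆ Set.Icc (-lam (2 * N + 1)) (lam (2 * N + 1)) := by
  have := lam_pos hpos hmono (j := 2 * N + 1) (by omega) le_rfl
  rintro x (h | h)
  · have h1 := nonneg_of_mem_bandsPos hpos hmono h
    have h2 := le_of_mem_bandsPos hmono h
    exact ⟨by linarith, h2⟩
  · have h1 := nonneg_of_mem_bandsPos hpos hmono h
    have h2 := le_of_mem_bandsPos hmono h
    exact ⟨by linarith, by linarith⟩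

theorem setIntegral_Icc_diff_Ioo {h : ℝ → ℝ} {ε A : ℝ} (hε : 0 < ε) (hA : ε < A)
    (hh : IntegrableOn h (Set.Icc (ξ - A) (ξ + A) \ Set.Ioo (ξ - ε) (ξ + ε))) :
    ∫ y in Set.Icc (ξ - A) (ξ + A) \ Set.Ioo (ξ - ε) (ξ + ε), h y =
      ∫ s in ε..A, (h (ξ + s) + h (ξ - s)) := by
  have hset : Set.Icc (ξ - A) (ξ + A) \ Set.Ioo (ξ - ε) (ξ + ε) =
      Set.Icc (ξ - A) (ξ - ε) ∪ Set.Icc (ξ + ε) (ξ + A) := by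
    ext y
    simp only [Set.mem_sdiff, Set.mem_Icc, Set.mem_Ioo, Set.mem_union, not_and, not_lt]
    constructor
    · rintro ⟨⟨h1, h2⟩, h3⟩
      rcases le_or_gt y (ξ - ε) with h | h
      · exact Or.inl ⟨h1, h⟩
      · exact Or.inr ⟨h3 h, h2⟩
    · rintro (⟨h1, h2⟩ | ⟨h1, h2⟩)
      · exact ⟨⟨h1, by linarith⟩, fun h => by linarith⟩
      · exact ⟨⟨by linarith, h2⟩, fun _ => h1⟩
  rw [hset] at hh ⊢
  have hl := hh.mono_set Set.subset_union_left
  have hr := hh.mono_set Set.subset_union_right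
  rw [setIntegral_union ?_ measurableSet_Icc hl hr, integral_Icc_eq_integral_Ioc,
    integral_Icc_eq_integral_Ioc, ← intervalIntegral.integral_of_le (by linarith),
    ← intervalIntegral.integral_of_le (by linarith)]
  · have hl' : IntervalIntegrable h volume (ξ - A) (ξ - ε) :=
      (intervalIntegrable_iff_integrableOn_Icc_of_le (by linarith)).2 hl
    have hr' : IntervalIntegrable h volume (ξ + ε) (ξ + A) :=
      (intervalIntegrable_iff_integrableOn_Icc_of_le (by linarith)).2 hr
    rw [intervalIntegral.integral_add, intervalIntegral.integral_comp_add_left,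
      intervalIntegral.integral_comp_sub_left, add_comm]
    · simpa using hr'.comp_add_left ξ
    · simpa using (hl'.comp_sub_left ξ).symm
  · exact Set.disjoint_left.2 fun y h1 h2 => by linarith [h1.2, h2.1]

/-- By Cauchy's theorem the integrals of the quotient over `[ξ - A, ξ + A]` tend to zero. Folding
about `ξ` and taking real parts turns them into the truncated integrals of the density against `1 /
(y - ξ)` plus an arctangent term, which supplies `π T(ξ)` at infinity. The folded integrand is
integrable up to `s = 0`, hence the principal value exists. -/
theorem hasHilbertTransform_density (hpos : 0 < lam 1)
    (hmono : StrictMonoOn lam (Set.Icc 1 (2 * N + 1)))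
    (hT : Tendsto (residual N lam S T) (Bornology.cobounded ℂ) (𝓝 0))
    (hξ : ξ ∈ bands N lam) (hξ' : ξ ∉ branchPoints N lam) :
    HasHilbertTransform (bands N lam) (fun y => density N lam S y) ξ (T.eval ξ : ℝ) := by
  set g := residualQuotient N lam S T ξ with hg_def
  have hg : HasDominatedBoundary g := hasDominatedBoundary_residualQuotient hpos hmono S T hξ'
  have hgi : LocallyIntegrable fun x : ℝ => (g x).re := locallyIntegrable_re hg.locallyIntegrable
  have hint := intervalIntegrable_of_locallyIntegrable hgi
  set k : ℝ → ℝ := fun s => (g (ξ + s : ℝ)).re + (g (ξ - s : ℝ)).re with hk_def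
  have hk1 : ∀ a b, IntervalIntegrable (fun s : ℝ => (g (ξ + s : ℝ)).re) volume a b :=
    fun a b => by simpa using (hint (ξ + a) (ξ + b)).comp_add_left ξ
  have hk2 : ∀ a b, IntervalIntegrable (fun s : ℝ => (g (ξ - s : ℝ)).re) volume a b :=
    fun a b => by simpa using (hint (ξ - a) (ξ - b)).comp_sub_left ξ
  have hk : ∀ a b, IntervalIntegrable k volume a b := fun a b => (hk1 a b).add (hk2 a b)
  -- A primitive of the folded integrand of the Hilbert transform. It is continuous with `Φ 0 = 0`,
  -- and it tends to `π T(ξ)` at infinity.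
  set Φ : ℝ → ℝ := fun A => (∫ s in (0 : ℝ)..A, k s) + 2 * T.eval ξ * Real.arctan A with hΦ_def
  have hΦc : Continuous Φ :=
    (intervalIntegral.continuous_primitive hk 0).add (continuous_const.mul Real.continuous_arctan)
  have hΦtop : Tendsto Φ atTop (𝓝 (Real.pi * T.eval ξ)) := by
    have h1 := (hg.tendsto_integral ((tendsto_mul_residualQuotient hT ξ).mono_left inf_le_left)
      ξ)
    have h2 := (Complex.continuous_re.tendsto 0).comp h1
    have h3 : Tendsto Real.arctan atTop (𝓝 (Real.pi / 2)) :=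
      Real.tendsto_arctan_atTop.mono_right nhdsWithin_le_nhds
    have h4 := h2.add (h3.const_mul (2 * T.eval ξ))
    rw [Complex.zero_re, zero_add,
      show 2 * T.eval ξ * (Real.pi / 2) = Real.pi * T.eval ξ by ring] at h4
    refine h4.congr fun A => ?_
    simp only [hΦ_def, Function.comp_apply]
    congr 1
    have hre : (∫ x in (ξ - A)..(ξ + A), g x).re = ∫ x in (ξ - A)..(ξ + A), (g x).re :=
      (Complex.reCLM.intervalIntegral_comp_comm
        (intervalIntegrable_of_locallyIntegrable hg.locallyIntegrable _ _)).symm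
    rw [hre, hk_def, intervalIntegral.integral_add (hk1 _ _) (hk2 _ _),
      intervalIntegral.integral_comp_add_left (fun x => (g (x : ℝ)).re),
      intervalIntegral.integral_comp_sub_left (fun x => (g (x : ℝ)).re), add_zero, sub_zero,
      add_comm (∫ x in ξ..(ξ + A), (g x).re), intervalIntegral.integral_add_adjacent_intervals (hint _ _) (hint _ _)]
  have hPV : ∀ ε : ℝ, 0 < ε → (∫ y in bands N lam \ Set.Ioo (ξ - ε) (ξ + ε),
      density N lam S y / ((y : ℂ) - ξ)) = ((Real.pi * T.eval ξ - Φ ε : ℝ) : ℂ) := by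
    intro ε hε
    set h : ℝ → ℝ := fun y => (density N lam S y).re / (y - ξ) with hh_def
    have h1 : (∫ y in bands N lam \ Set.Ioo (ξ - ε) (ξ + ε), density N lam S y / ((y : ℂ) - ξ)) =
        ((∫ y in bands N lam \ Set.Ioo (ξ - ε) (ξ + ε), h y : ℝ) : ℂ) := by
      rw [← integral_complex_ofReal]
      refine setIntegral_congr_fun (measurableSet_bands.diff measurableSet_Ioo) fun y hy => ?_
      have := density_im_of_mem hpos hmono S hy.1
      simp only [hh_def]
      push_cast
      congr 1
      exact Complex.ext rfl (by simpa using this)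
    rw [h1]
    congr 1
    -- The real part of the density vanishes off `Γ`, so the left side equals the integral over any
    -- large symmetric interval about `ξ` with the same hole.
    have h2 : ∀ᶠ A in atTop, (∫ y in bands N lam \ Set.Ioo (ξ - ε) (ξ + ε), h y) = Φ A - Φ ε := by
      filter_upwards [eventually_gt_atTop ε, eventually_ge_atTop (|ξ| + lam (2 * N + 1))]
        with A hA1 hA2
      have hsub : bands N lam ⊆ Set.Icc (ξ - A) (ξ + A) := fun y hy => by
        have := bands_subset_Icc hpos hmono hy
        exact ⟨by linarith [this.1, le_abs_self ξ], by linarith [this.2, neg_abs_le ξ]⟩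
      have h3 : (∫ y in bands N lam \ Set.Ioo (ξ - ε) (ξ + ε), h y) =
          ∫ y in Set.Icc (ξ - A) (ξ + A) \ Set.Ioo (ξ - ε) (ξ + ε), h y := by
        refine (setIntegral_eq_of_subset_of_forall_sdiff_eq_zero
          (measurableSet_Icc.diff measurableSet_Ioo) (Set.sdiff_subset_sdiff_left hsub) ?_).symm
        intro y hy
        have : y ∉ bands N lam := fun hyb => hy.2 ⟨hyb, hy.1.2⟩
        simp [hh_def, density_re_of_notMem hpos hmono S this]
      have hcpt : IsCompact (Set.Icc (ξ - A) (ξ + A) \ Set.Ioo (ξ - ε) (ξ + ε)) :=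
        isCompact_Icc.diff isOpen_Ioo
      have hhi : IntegrableOn h (Set.Icc (ξ - A) (ξ + A) \ Set.Ioo (ξ - ε) (ξ + ε)) := by
        have hd : LocallyIntegrable fun y : ℝ => (density N lam S y).re :=
          locallyIntegrable_re (locallyIntegrable_density hpos hmono S)
        simp only [hh_def, div_eq_mul_inv]
        refine (hd.integrableOn_isCompact hcpt).mul_continuousOn ?_ hcpt
        refine ContinuousOn.inv₀ (by fun_prop) fun y hy h0 => hy.2 ?_
        have : y = ξ := by linarith
        exact ⟨by linarith, by linarith⟩
      rw [h3, setIntegral_Icc_diff_Ioo hε hA1 hhi]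
      have h4 : ∫ s in ε..A, (h (ξ + s) + h (ξ - s)) =
          ∫ s in ε..A, (k s + 2 * T.eval ξ * (1 + s ^ 2)⁻¹) := by
        refine intervalIntegral.integral_congr fun s hs => ?_
        rw [Set.uIcc_of_le hA1.le] at hs
        have hs0 : 0 < s := hε.trans_le hs.1
        have := re_residualQuotient_add (T := T) hs0 (density_im_of_mem hpos hmono S hξ)
        simp only [hk_def, hg_def, hh_def, this]
        rw [show ξ + s - ξ = s by ring, show ξ - s - ξ = -s by ring, div_neg]
        ring
      have hat : IntervalIntegrable (fun s : ℝ => 2 * T.eval ξ * (1 + s ^ 2)⁻¹) volume ε A := by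
        refine Continuous.intervalIntegrable ?_ _ _
        exact continuous_const.mul (Continuous.inv₀ (by fun_prop) fun s => by positivity)
      rw [h4, intervalIntegral.integral_add (hk _ _) hat, intervalIntegral.integral_const_mul,
        integral_inv_one_add_sq,
        ← intervalIntegral.integral_interval_sub_left (hk 0 A) (hk 0 ε)]
      simp only [hΦ_def]
      ring
    have h5 : Tendsto (fun A => Φ A - Φ ε) atTop (𝓝 (Real.pi * T.eval ξ - Φ ε)) :=
      hΦtop.sub_const _
    exact tendsto_nhds_unique (tendsto_const_nhds.congr' h2) h5
  have hlim : Tendsto (fun ε => (1 / Real.pi : ℂ) * ((Real.pi * T.eval ξ - Φ ε : ℝ) : ℂ)) (𝓝[>] 0)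
      (𝓝 ((1 / Real.pi : ℂ) * ((Real.pi * T.eval ξ - Φ 0 : ℝ) : ℂ))) := by
    refine Tendsto.mono_left (Continuous.tendsto ?_ 0) nhdsWithin_le_nhds
    exact continuous_const.mul (Complex.continuous_ofReal.comp (continuous_const.sub hΦc))
  have hΦ0 : Φ 0 = 0 := by simp [hΦ_def]
  rw [HasHilbertTransform]
  have hval : (1 / Real.pi : ℂ) * ((Real.pi * T.eval ξ - Φ 0 : ℝ) : ℂ) = (T.eval ξ : ℝ) := by
    have : (Real.pi : ℂ) ≠ 0 := by exact_mod_cast Real.pi_ne_zero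
    rw [hΦ0]
    push_cast
    field_simp
    ring
  rw [hval] at hlim
  refine hlim.congr' ?_
  filter_upwards [self_mem_nhdsWithin] with ε hε
  rw [hPV ε hε]

end

/-! ### The logarithmic kernel and the dispersion relation -/

/-- The kernel `log (z + η) - log (z - η)`. -/
noncomputable def logKernel (η : ℝ) (z : ℂ) : ℂ := Complex.log (z + η) - Complex.log (z - η)

theorem tendsto_log_upper {x : ℝ} (hx : x ≠ 0) :
    Tendsto Complex.log (𝓝[{z | 0 < z.im}] (x : ℂ)) (𝓝 (Complex.log x)) := by
  rcases hx.lt_or_gt with h | h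
  · exact (Complex.continuousWithinAt_log_of_re_neg_of_im_zero (by simpa using h)
      (Complex.ofReal_im _)).tendsto.mono_left (nhdsWithin_mono _ fun z (hz : 0 < z.im) => show 0 ≤ z.im from hz.le)
  · exact (continuousAt_clog (by simpa using h)).tendsto.mono_left nhdsWithin_le_nhds

theorem tendsto_logKernel {η x : ℝ} (h1 : x + η ≠ 0) (h2 : x - η ≠ 0) :
    Tendsto (fun δ : ℝ => logKernel η (x + δ * Complex.I)) (𝓝[>] 0) (𝓝 (logKernel η x)) := by
  have key : ∀ c : ℝ, x + c ≠ 0 → Tendsto (fun δ : ℝ => Complex.log (x + δ * Complex.I + c))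
      (𝓝[>] 0) (𝓝 (Complex.log (x + c))) := fun c hc => by
    have := (tendsto_log_upper hc).comp (tendsto_add_mul_I (x + c))
    rw [Complex.ofReal_add] at this
    refine this.congr fun δ => ?_
    rw [Function.comp_apply]
    congr 1
    ring
  have h3 := key (-η) (by rwa [← sub_eq_add_neg])
  simp only [Complex.ofReal_neg, ← sub_eq_add_neg] at h3
  exact (key η h1).sub h3

theorem differentiableOn_logKernel (η : ℝ) :
    DifferentiableOn ℂ (logKernel η) {z | 0 < z.im} := by
  intro z hz
  have hz' : 0 < z.im := hz
  refine DifferentiableAt.differentiableWithinAt ?_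
  refine ((differentiableAt_id.add_const _).clog ?_).sub ((differentiableAt_id.sub_const _).clog ?_)
  · exact Complex.mem_slitPlane_iff.2 (Or.inr (by simpa using hz'.ne'))
  · exact Complex.mem_slitPlane_iff.2 (Or.inr (by simpa using hz'.ne'))

/-- The bound involves `z.re` but not the height, as a dominating function on the real line must.
The argument contributes at most `π ≤ 4`. -/
theorem norm_log_le {z : ℂ} {B : ℝ} (hx : z.re ≠ 0) (hB : ‖z‖ ≤ B) :
    ‖Complex.log z‖ ≤ 4 * (B + 2) + 4 * |z.re| ^ (-(1 / 4) : ℝ) := by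
  have h0 : 0 < |z.re| := abs_pos.2 hx
  have h1 : |z.re| ≤ ‖z‖ := Complex.abs_re_le_norm z
  have h2 := abs_log_le_rpow (h0.trans_le h1)
  have h3 : ‖z‖ ^ (-(1 / 4) : ℝ) ≤ |z.re| ^ (-(1 / 4) : ℝ) :=
    Real.rpow_le_rpow_of_nonpos h0 h1 (by norm_num)
  have h4 := Complex.norm_le_abs_re_add_abs_im (Complex.log z)
  rw [Complex.log_re, Complex.log_im] at h4
  have h5 := Complex.abs_arg_le_pi z
  have h6 := Real.pi_le_four
  linarith

theorem norm_logKernel_le {η x δ B : ℝ} (h1 : x + η ≠ 0) (h2 : x - η ≠ 0)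
    (hB : ‖(x + δ * Complex.I : ℂ)‖ ≤ B) :
    ‖logKernel η (x + δ * Complex.I)‖ ≤
      8 * (B + |η| + 2) + 4 * (|x + η| ^ (-(1 / 4) : ℝ) + |x - η| ^ (-(1 / 4) : ℝ)) := by
  have e1 : ((x : ℂ) + δ * Complex.I + η).re = x + η := by simp
  have e2 : ((x : ℂ) + δ * Complex.I - η).re = x - η := by simp
  have n1 : ‖(x : ℂ) + δ * Complex.I + η‖ ≤ B + |η| := by
    refine (norm_add_le _ _).trans ?_
    rw [Complex.norm_real, Real.norm_eq_abs]
    linarith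
  have n2 : ‖(x : ℂ) + δ * Complex.I - η‖ ≤ B + |η| := by
    refine (norm_sub_le _ _).trans ?_
    rw [Complex.norm_real, Real.norm_eq_abs]
    linarith
  have l1 := norm_log_le (by rwa [e1]) n1
  have l2 := norm_log_le (by rwa [e2]) n2
  rw [e1] at l1
  rw [e2] at l2
  refine (norm_sub_le _ _).trans ?_
  linarith

/-- Mean value inequality for `log` on the horizontal segment from `z - η` to `z + η`. It lies in
the upper half plane, clear of the cut of the logarithm, and there the derivative is at most `1 /
(‖z‖ - η) ≤ 2 / ‖z‖`. -/
theorem norm_mul_logKernel_le {η : ℝ} {z : ℂ} (hη : 0 ≤ η) (him : 0 < z.im)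
    (hz : 2 * η + 1 ≤ ‖z‖) : ‖z * logKernel η z‖ ≤ 4 * η := by
  have hpos : 0 < ‖z‖ - η := by linarith
  set s : Set ℂ := {w | w.im = z.im} ∩ Metric.closedBall z η with hs
  have hconv : Convex ℝ s := by
    refine Convex.inter ?_ (convex_closedBall z η)
    exact (convex_singleton z.im).linear_preimage Complex.imLm
  have hmem : ∀ c : ℝ, |c| ≤ η → z + c ∈ s := fun c hc => ⟨by
    show (z + c).im = z.im
    simp, by simpa [Metric.mem_closedBall, dist_eq_norm] using hc⟩
  have hD : ∀ w ∈ s, HasDerivWithinAt Complex.log w⁻¹ s w := fun w hw => by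
    have : w.im = z.im := hw.1
    exact (Complex.hasDerivAt_log (Complex.mem_slitPlane_iff.2
      (Or.inr (by rw [this]; exact him.ne')))).hasDerivWithinAt
  have hbound : ∀ w ∈ s, ‖w⁻¹‖ ≤ (‖z‖ - η)⁻¹ := fun w hw => by
    have h1 : ‖w - z‖ ≤ η := by simpa [dist_eq_norm] using hw.2
    have h2 := norm_sub_norm_le z w
    rw [norm_sub_rev] at h2
    rw [norm_inv]
    exact inv_anti₀ hpos (by linarith)
  have h := hconv.norm_image_sub_le_of_norm_hasDerivWithin_le hD hbound
    (hmem (-η) (by rw [abs_neg, abs_of_nonneg hη])) (hmem η (by rw [abs_of_nonneg hη]))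
  have e : z + η - (z + (-η : ℝ)) = ((2 * η : ℝ) : ℂ) := by push_cast; ring
  rw [e, Complex.norm_real, Real.norm_eq_abs, abs_of_nonneg (by linarith), Complex.ofReal_neg,
    ← sub_eq_add_neg] at h
  rw [norm_mul, logKernel]
  refine (mul_le_mul_of_nonneg_left h (norm_nonneg z)).trans ?_
  have : ‖z‖ * (‖z‖ - η)⁻¹ ≤ 2 := by
    rw [← div_eq_mul_inv, div_le_iff₀ hpos]
    linarith
  nlinarith

section

variable {N : ℕ} {lam : ℕ → ℝ} {S T : ℝ[X]} {η : ℝ}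

theorem ae_add_ne_zero (c : ℝ) : ∀ᵐ x : ℝ, x + c ≠ 0 := by
  filter_upwards [measure_eq_zero_iff_ae_notMem.1 (Real.volume_singleton (a := -c))] with x hx h
  exact hx (by simpa using eq_neg_of_add_eq_zero_left h)

theorem hasDominatedBoundary_residual_mul_logKernel (hpos : 0 < lam 1)
    (hmono : StrictMonoOn lam (Set.Icc 1 (2 * N + 1))) (S T : ℝ[X]) (η : ℝ) :
    HasDominatedBoundary (fun z => residual N lam S T z * logKernel η z) where
  differentiableOn := (differentiableOn_residual hpos hmono S T).mul (differentiableOn_logKernel η)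
  dominated B := by
    obtain ⟨C, hC0, hC⟩ := exists_norm_residual_le N lam S T B
    have hR := locallyIntegrable_inv_norm_root hpos hmono
    have hR' := locallyIntegrable_norm_root_rpow hpos hmono (show (-2 : ℝ) < -(3 / 2) by norm_num)
    have hq : ∀ c : ℝ, LocallyIntegrable fun x : ℝ => |x - c| ^ (-(1 / 4) : ℝ) := fun c =>
      locallyIntegrable_abs_sub_rpow c (by norm_num)
    have hq' : ∀ c : ℝ, LocallyIntegrable fun x : ℝ => |x - c| ^ (-(3 / 4) : ℝ) := fun c =>
      locallyIntegrable_abs_sub_rpow c (by norm_num)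
    -- Dominates `(1 / |R| + 1) |x - c| ^ (-1/4)` even when `c` is a branch point, by
    -- `mul_le_rpow_add_pow`; all exponents stay in the integrable range.
    set H : ℝ → ℝ → ℝ := fun c x => ‖root N lam x‖ ^ (-(3 / 2) : ℝ) + |x - c| ^ (-(3 / 4) : ℝ) +
      |x - c| ^ (-(1 / 4) : ℝ) with hH_def
    have hH : ∀ c, LocallyIntegrable (H c) := fun c => (hR'.add (hq' c)).add (hq c)
    have hHle : ∀ c x : ℝ, (‖root N lam x‖⁻¹ + 1) * |x - c| ^ (-(1 / 4) : ℝ) ≤ H c x :=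
      fun c x => by
        have h1 := mul_le_rpow_add_pow (inv_nonneg.2 (norm_nonneg (root N lam x)))
          (Real.rpow_nonneg (abs_nonneg (x - c)) (-(1 / 4)))
        have h2 : (‖root N lam x‖⁻¹) ^ (3 / 2 : ℝ) = ‖root N lam x‖ ^ (-(3 / 2) : ℝ) := by
          rw [Real.inv_rpow (norm_nonneg _), Real.rpow_neg (norm_nonneg _)]
        have h3 : (|x - c| ^ (-(1 / 4) : ℝ)) ^ 3 = |x - c| ^ (-(3 / 4) : ℝ) := by
          rw [← Real.rpow_natCast, ← Real.rpow_mul (abs_nonneg _)]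
          norm_num
        rw [h2, h3] at h1
        simp only [hH_def]
        linarith
    refine ⟨fun x => C * ((8 * (B + |η| + 2)) * (‖root N lam x‖⁻¹ + 1) + 4 * (H (-η) x + H η x)),
      (((hR.add (locallyIntegrable_const 1)).smul (8 * (B + |η| + 2))).add
        (((hH (-η)).add (hH η)).smul (4 : ℝ))).smul C, ?_⟩
    filter_upwards [ae_notMem_branchPoints (N := N) (lam := lam), ae_add_ne_zero η,
      ae_add_ne_zero (-η)] with x hx h1 h2 δ _ hB
    rw [← sub_eq_add_neg] at h2
    have hf := hC x hx δ hB
    have hK := norm_logKernel_le h1 h2 hB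
    have hl := hHle (-η) x
    have hr := hHle η x
    rw [sub_neg_eq_add] at hl
    rw [norm_mul]
    have hRnn : 0 ≤ ‖root N lam x‖⁻¹ + 1 := by positivity
    refine (mul_le_mul hf hK (norm_nonneg _) (by positivity)).trans ?_
    rw [mul_assoc]
    refine mul_le_mul_of_nonneg_left ?_ hC0
    nlinarith
  tendsto := by
    filter_upwards [ae_notMem_branchPoints (N := N) (lam := lam), ae_add_ne_zero η,
      ae_add_ne_zero (-η)] with x hx h1 h2
    rw [← sub_eq_add_neg] at h2
    exact ((tendsto_residual_upper hpos hmono S T hx).comp (tendsto_add_mul_I x)).mul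
      (tendsto_logKernel h1 h2)

theorem tendsto_mul_residual_mul_logKernel
    (hT : Tendsto (residual N lam S T) (Bornology.cobounded ℂ) (𝓝 0)) (hη : 0 ≤ η) :
    Tendsto (fun z => z * (residual N lam S T z * logKernel η z))
      (Bornology.cobounded ℂ ⊓ 𝓟 {z | 0 < z.im}) (𝓝 0) := by
  have hb : IsBoundedUnder (· ≤ ·) (Bornology.cobounded ℂ ⊓ 𝓟 {z | 0 < z.im})
      (norm ∘ fun z => z * logKernel η z) := by
    refine isBoundedUnder_of_eventually_le (a := 4 * η) ?_
    rw [eventually_inf_principal]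
    filter_upwards [tendsto_norm_cobounded_atTop.eventually_ge_atTop (2 * η + 1)] with z hz him
    exact norm_mul_logKernel_le hη him hz
  refine ((hT.mono_left inf_le_left).zero_mul_isBoundedUnder_le hb).congr fun z => ?_
  ring

theorem re_logKernel (η x : ℝ) (h1 : x + η ≠ 0) (h2 : x - η ≠ 0) :
    (logKernel η x).re = Real.log |(x + η) / (x - η)| := by
  rw [logKernel, ← Complex.ofReal_add, ← Complex.ofReal_sub, Complex.sub_re, Complex.log_ofReal_re,
    Complex.log_ofReal_re, Real.log_abs, Real.log_div h1 h2]

theorem im_logKernel (hη : 0 ≤ η) {x : ℝ} (h1 : x + η ≠ 0) (h2 : x - η ≠ 0) :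
    (logKernel η x).im = if x ∈ Set.Ioo (-η) η then -Real.pi else 0 := by
  rw [logKernel, ← Complex.ofReal_add, ← Complex.ofReal_sub, Complex.sub_im, Complex.log_im,
    Complex.log_im]
  rcases h1.lt_or_gt with h | h
  · rw [if_neg fun hx => by linarith [hx.1], Complex.arg_ofReal_of_neg h,
      Complex.arg_ofReal_of_neg (by linarith), sub_self]
  · rcases h2.lt_or_gt with h' | h'
    · rw [if_pos ⟨by linarith, by linarith⟩, Complex.arg_ofReal_of_nonneg h.le,
        Complex.arg_ofReal_of_neg h', zero_sub]
    · rw [if_neg fun hx => by linarith [hx.2], Complex.arg_ofReal_of_nonneg h.le,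
        Complex.arg_ofReal_of_nonneg h'.le, sub_self]

theorem density_re_neg (hpos : 0 < lam 1) (hmono : StrictMonoOn lam (Set.Icc 1 (2 * N + 1)))
    (hS : S.comp (-X) = -S) (x : ℝ) :
    (density N lam S (-x : ℝ)).re = -(density N lam S x).re := by
  by_cases hx : x ∈ bands N lam
  · rw [density_neg_of_mem hpos hmono hS hx, Complex.neg_re]
  · rw [density_re_of_notMem hpos hmono S hx,
      density_re_of_notMem hpos hmono S fun h => hx (neg_mem_bands_iff.1 h), neg_zero]

theorem measurableSet_bandsPos : MeasurableSet (bandsPos N lam) :=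
  measurableSet_Icc.union (Finset.measurableSet_biUnion _ fun _ _ => measurableSet_Icc)

/-- The integral of `f · logKernel` over the real line is zero in the limit of symmetric intervals.
Its real part is `log |(x + η) / (x - η)| Re f`, plus `π Im f` on `(-η, η)`. The first term is even,
as a product of two odd functions, and vanishes off `Γ`, so it gives twice the integral over `Γ⁺`;
in the second, `Im f = Im density - T`. -/
theorem integral_log_mul_density (hpos : 0 < lam 1)
    (hmono : StrictMonoOn lam (Set.Icc 1 (2 * N + 1))) (hS : S.comp (-X) = -S)
    (hT : Tendsto (residual N lam S T) (Bornology.cobounded ℂ) (𝓝 0)) (hη : 0 ≤ η) :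
    IntegrableOn (fun μ : ℝ => (Real.log |(μ + η) / (μ - η)| : ℂ) * density N lam S μ)
        (bandsPos N lam) ∧
      ∫ μ in bandsPos N lam, (Real.log |(μ + η) / (μ - η)| : ℂ) * density N lam S μ =
        ((Real.pi / 2 * ∫ x in (-η)..η, (T.eval x - (density N lam S x).im) : ℝ) : ℂ) := by
  have hdom := hasDominatedBoundary_residual_mul_logKernel hpos hmono S T η
  have hF := locallyIntegrable_re hdom.locallyIntegrable
  have hf : LocallyIntegrable fun x : ℝ => (residual N lam S T x).im :=
    locallyIntegrable_im (hasDominatedBoundary_residual hpos hmono S T).locallyIntegrable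
  have him : ∀ x : ℝ, (residual N lam S T x).im = (density N lam S x).im - T.eval x := fun x => by
    simp [residual, aeval_ofReal_complex]
  have hre : ∀ x : ℝ, (residual N lam S T x).re = (density N lam S x).re := fun x => by
    simp [residual, aeval_ofReal_complex]
  set φ : ℝ → ℝ := fun x => Real.pi * (residual N lam S T x).im with hφ_def
  have hφ : LocallyIntegrable ((Set.Ioo (-η) η).indicator φ) :=
    (hf.smul Real.pi).indicator measurableSet_Ioo
  set m : ℝ → ℝ := fun x => Real.log |(x + η) / (x - η)| * (density N lam S x).re with hm_def
  have hsplit : ∀ᵐ x : ℝ, (residual N lam S T x * logKernel η x).re -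
      (Set.Ioo (-η) η).indicator φ x = m x := by
    filter_upwards [ae_add_ne_zero η, ae_add_ne_zero (-η)] with x h1 h2
    rw [← sub_eq_add_neg] at h2
    rw [Complex.mul_re, re_logKernel η x h1 h2, im_logKernel hη h1 h2, hre]
    simp only [hm_def, hφ_def, Set.indicator_apply]
    split_ifs <;> ring
  -- Absolute convergence comes from a difference of two locally integrable functions, so `η` may be
  -- a branch point.
  have hm : LocallyIntegrable m := (hF.sub hφ).congr hsplit
  have hbounded : bandsPos N lam ⊆ Set.Icc 0 (lam (2 * N + 1)) := fun x hx =>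
    ⟨nonneg_of_mem_bandsPos hpos hmono hx, le_of_mem_bandsPos hmono hx⟩
  have hofReal : ∀ x ∈ bandsPos N lam,
      (Real.log |(x + η) / (x - η)| : ℂ) * density N lam S x = ((m x : ℝ) : ℂ) := fun x hx => by
    have : density N lam S x = ((density N lam S x).re : ℂ) :=
      Complex.ext rfl (by simpa using density_im_of_mem hpos hmono S (Or.inl hx))
    rw [this]
    simp [hm_def]
  have hmi : IntegrableOn m (bandsPos N lam) :=
    (hm.integrableOn_isCompact isCompact_Icc).mono_set hbounded
  refine ⟨(integrableOn_congr_fun hofReal measurableSet_bandsPos).2 hmi.ofReal, ?_⟩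
  rw [setIntegral_congr_fun measurableSet_bandsPos hofReal, integral_complex_ofReal]
  congr 1
  have hmneg : ∀ x, m (-x) = m x := fun x => by
    simp only [hm_def]
    rw [density_re_neg hpos hmono hS, mul_neg, ← neg_mul, ← Real.log_inv, ← abs_inv, inv_div,
      show -x + η = -(x - η) by ring, show -x - η = -(x + η) by ring, neg_div_neg_eq]
  have hlim : Tendsto (fun A : ℝ => ∫ x in (0 - A)..(0 + A),
      (residual N lam S T x * logKernel η x).re) atTop (𝓝 0) := by
    have h1 := (Complex.continuous_re.tendsto 0).comp (by
      simpa using hdom.tendsto_integral (tendsto_mul_residual_mul_logKernel hT hη) 0)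
    rw [Complex.zero_re] at h1
    refine h1.congr fun A => ?_
    rw [zero_sub, zero_add]
    exact (Complex.reCLM.intervalIntegral_comp_comm
        (intervalIntegrable_of_locallyIntegrable hdom.locallyIntegrable _ _)).symm
  have hconst : ∀ᶠ A : ℝ in atTop,
      (∫ x in (0 - A)..(0 + A), (residual N lam S T x * logKernel η x).re) =
        2 * (∫ x in bandsPos N lam, m x) + ∫ x in (-η)..η, φ x := by
    filter_upwards [eventually_ge_atTop η, eventually_ge_atTop (lam (2 * N + 1)),
      eventually_ge_atTop 0] with A hA1 hA2 hA0
    have hmI := intervalIntegrable_of_locallyIntegrable hm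
    have e1 : (∫ x in (0 - A)..(0 + A), (residual N lam S T x * logKernel η x).re) =
        ∫ x in (-A)..A, (m x + (Set.Ioo (-η) η).indicator φ x) := by
      rw [zero_sub, zero_add]
      refine intervalIntegral.integral_congr_ae ?_
      filter_upwards [hsplit] with x hx _
      linarith
    have e2 : (∫ x in (-A)..A, m x) = 2 * ∫ x in bandsPos N lam, m x := by
      rw [← intervalIntegral.integral_add_adjacent_intervals (hmI (-A) 0) (hmI 0 A)]
      have : (∫ x in (-A)..0, m x) = ∫ x in (0 : ℝ)..A, m x := by
        have := intervalIntegral.integral_comp_neg (a := 0) (b := A) m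
        rw [neg_zero] at this
        rw [← this]
        exact intervalIntegral.integral_congr fun x _ => hmneg x
      rw [this, ← two_mul, intervalIntegral.integral_of_le hA0, ← integral_Icc_eq_integral_Ioc]
      congr 1
      refine setIntegral_eq_of_subset_of_forall_sdiff_eq_zero measurableSet_Icc
        (hbounded.trans (Set.Icc_subset_Icc_right hA2)) fun x hx => ?_
      have : x ∉ bands N lam := fun h => hx.2 ((mem_bands_iff_of_nonneg hpos hmono hx.1.1).1 h)
      simp [hm_def, density_re_of_notMem hpos hmono S this]
    have e3 : (∫ x in (-A)..A, (Set.Ioo (-η) η).indicator φ x) = ∫ x in (-η)..η, φ x := by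
      rw [intervalIntegral.integral_of_le (by linarith), intervalIntegral.integral_of_le
        (by linarith), integral_Ioc_eq_integral_Ioo (x := -η), setIntegral_indicator
        measurableSet_Ioo, Set.inter_eq_right.2]
      exact fun x hx => ⟨by linarith [hx.1], by linarith [hx.2]⟩
    rw [e1, intervalIntegral.integral_add (hmI _ _)
      (intervalIntegrable_of_locallyIntegrable hφ _ _), e2, e3]
  have hzero := tendsto_nhds_unique (tendsto_const_nhds.congr' (hconst.mono fun _ h => h.symm)) hlim
  have e4 : (∫ x in (-η)..η, φ x) =
      -(Real.pi * ∫ x in (-η)..η, (T.eval x - (density N lam S x).im)) := by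
    rw [← intervalIntegral.integral_const_mul, ← intervalIntegral.integral_neg]
    refine intervalIntegral.integral_congr fun x _ => ?_
    simp only [hφ_def, him]
    ring
  rw [e4] at hzero
  linarith

end

/-! ### Gap integrals: zeros in the gaps and solvability -/

/-- The integral of `S / R`, the imaginary part of `i S / R`, over the `j`-th gap. -/
noncomputable def gapIntegral (N : ℕ) (lam : ℕ → ℝ) (j : ℕ) (S : ℝ[X]) : ℝ :=
  ∫ x in (lam (2 * j - 1))..(lam (2 * j)), (density N lam S x).im

section

variable {N : ℕ} {lam : ℕ → ℝ} {S T : ℝ[X]} {j : ℕ}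

theorem gap_pos (hpos : 0 < lam 1) (hmono : StrictMonoOn lam (Set.Icc 1 (2 * N + 1)))
    (hj : j ∈ Finset.Icc 1 N) : 0 < lam (2 * j - 1) ∧ lam (2 * j - 1) < lam (2 * j) := by
  rw [Finset.mem_Icc] at hj
  exact ⟨lam_pos hpos hmono (by omega) (by omega), lam_lt hmono (by omega) (by omega) (by omega)⟩

theorem notMem_bands_of_mem_gap (hpos : 0 < lam 1)
    (hmono : StrictMonoOn lam (Set.Icc 1 (2 * N + 1))) (hj : j ∈ Finset.Icc 1 N) {x : ℝ}
    (hx : x ∈ Set.Ioo (lam (2 * j - 1)) (lam (2 * j))) : x ∉ bands N lam := by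
  have h0 := (gap_pos hpos hmono hj).1
  rw [mem_bands_iff_of_nonneg hpos hmono (h0.trans hx.1).le, mem_bandsPos]
  rw [Finset.mem_Icc] at hj
  rintro (h | ⟨k, hk, h⟩)
  · have := lam_le hmono le_rfl (show 1 ≤ 2 * j - 1 by omega) (by omega)
    linarith [hx.1, h.2]
  · rw [Finset.mem_Icc] at hk
    rcases lt_or_ge k j with hkj | hkj
    · have := lam_le hmono (show 1 ≤ 2 * k + 1 by omega) (show 2 * k + 1 ≤ 2 * j - 1 by omega)
        (by omega)
      linarith [hx.1, h.2]
    · have := lam_le hmono (show 1 ≤ 2 * j by omega) (show 2 * j ≤ 2 * k by omega) (by omega)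
      linarith [hx.2, h.1]

theorem branchPoints_subset_bands (hmono : StrictMonoOn lam (Set.Icc 1 (2 * N + 1)))
    (hpos : 0 < lam 1) : branchPoints N lam ⊆ bands N lam := by
  have key : ∀ j ∈ Finset.Icc 1 (2 * N + 1), lam j ∈ bandsPos N lam := fun j hj => by
    rw [Finset.mem_Icc] at hj
    rw [mem_bandsPos]
    rcases Nat.even_or_odd' j with ⟨k, rfl | rfl⟩
    · exact Or.inr ⟨k, Finset.mem_Icc.2 ⟨by omega, by omega⟩, le_rfl,
        lam_le hmono (by omega) (by omega) (by omega)⟩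
    · rcases Nat.eq_zero_or_pos k with rfl | hk
      · exact Or.inl ⟨hpos.le, le_rfl⟩
      · exact Or.inr ⟨k, Finset.mem_Icc.2 ⟨by omega, by omega⟩,
          lam_le hmono (by omega) (by omega) (by omega), le_rfl⟩
  rintro x ⟨j, hj, rfl | rfl⟩
  · exact Or.inl (key j hj)
  · exact neg_mem_bands_iff.2 (Or.inl (key j hj))

theorem continuousAt_density (hpos : 0 < lam 1)
    (hmono : StrictMonoOn lam (Set.Icc 1 (2 * N + 1))) (S : ℝ[X]) {x : ℝ}
    (hx : x ∉ bands N lam) : ContinuousAt (density N lam S) x :=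
  tendsto_density S le_rfl (differentiableAt_root hpos hmono fun y hy h =>
    hx (by rwa [Complex.ofReal_inj.1 h])).continuousAt
    fun h => hx (branchPoints_subset_bands hmono hpos h)

theorem density_im_eq_zero_iff (hpos : 0 < lam 1)
    (hmono : StrictMonoOn lam (Set.Icc 1 (2 * N + 1))) {x : ℝ} (hx : x ∉ bands N lam) :
    (density N lam S x).im = 0 ↔ S.eval x = 0 := by
  have h0 : root N lam x ≠ 0 := root_ofReal_ne_zero fun h =>
    hx (branchPoints_subset_bands hmono hpos h)
  obtain ⟨r, hr, -⟩ := root_of_notMem_bands hpos hmono hx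
  have hr0 : r ≠ 0 := by
    rintro rfl
    simp [hr] at h0
  rw [density, aeval_ofReal_complex, hr, mul_div_assoc, ← Complex.ofReal_div]
  simp [hr0]

/-- Without a zero of `S`, the real continuous function `S / R` would have constant sign on the open
gap and a nonzero integral. -/
theorem exists_eval_eq_zero_of_gapIntegral (hpos : 0 < lam 1)
    (hmono : StrictMonoOn lam (Set.Icc 1 (2 * N + 1))) (hj : j ∈ Finset.Icc 1 N)
    (h : gapIntegral N lam j S = 0) :
    ∃ a ∈ Set.Ioo (lam (2 * j - 1)) (lam (2 * j)), S.eval a = 0 := by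
  by_contra! hne
  set f : ℝ → ℝ := fun x => (density N lam S x).im with hf_def
  have hlt := (gap_pos hpos hmono hj).2
  have hint : IntervalIntegrable f volume (lam (2 * j - 1)) (lam (2 * j)) :=
    intervalIntegrable_of_locallyIntegrable
      (locallyIntegrable_im (locallyIntegrable_density hpos hmono S)) _ _
  have hf0 : ∀ x ∈ Set.Ioo (lam (2 * j - 1)) (lam (2 * j)), f x ≠ 0 := fun x hx h0 =>
    hne x hx ((density_im_eq_zero_iff hpos hmono
      (notMem_bands_of_mem_gap hpos hmono hj hx)).1 h0)
  have hcont : ContinuousOn f (Set.Ioo (lam (2 * j - 1)) (lam (2 * j))) := fun x hx =>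
    (Complex.continuous_im.continuousAt.comp
      (ContinuousAt.comp (f := fun x : ℝ => (x : ℂ)) (continuousAt_density hpos hmono S
        (notMem_bands_of_mem_gap hpos hmono hj hx))
        Complex.continuous_ofReal.continuousAt)).continuousWithinAt
  -- The midpoint serves as reference for the sign: multiplication by `f c` makes the integrand
  -- positive.
  set c := (lam (2 * j - 1) + lam (2 * j)) / 2 with hc_def
  have hc : c ∈ Set.Ioo (lam (2 * j - 1)) (lam (2 * j)) :=
    ⟨by linarith, by linarith⟩
  have hsign : ∀ x ∈ Set.Ioo (lam (2 * j - 1)) (lam (2 * j)), 0 < f x * f c := by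
    intro x hx
    by_contra! hcon
    have hsub : Set.uIcc x c ⊆ Set.Ioo (lam (2 * j - 1)) (lam (2 * j)) :=
      Set.ordConnected_Ioo.uIcc_subset hx hc
    have : (0 : ℝ) ∈ Set.uIcc (f x) (f c) := by
      rw [Set.mem_uIcc]
      rcases mul_nonpos_iff.1 hcon with h' | h'
      · exact Or.inr ⟨h'.2, h'.1⟩
      · exact Or.inl h'
    obtain ⟨y, hy, hy0⟩ := intermediate_value_uIcc (hcont.mono hsub) this
    exact hf0 y (hsub hy) hy0
  have := intervalIntegral.intervalIntegral_pos_of_pos_on (hint.mul_const (f c)) hsign hlt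
  rw [intervalIntegral.integral_mul_const] at this
  rw [gapIntegral] at h
  simp [hf_def, h] at this

theorem eval_neg_of_odd (hS : S.comp (-X) = -S) (x : ℝ) : S.eval (-x) = -S.eval x := by
  have := congrArg (eval x) hS
  simpa only [eval_comp, eval_neg, eval_X] using this

/-- By oddness the zeros include `0` and `±a j`. The gaps are disjoint and positive, so these are `2
N + 1` distinct points, more than the degree allows. -/
theorem eq_zero_of_odd_of_eval_gap (hpos : 0 < lam 1)
    (hmono : StrictMonoOn lam (Set.Icc 1 (2 * N + 1))) (hS : S.comp (-X) = -S)
    (hdeg : S.natDegree ≤ 2 * N) {a : ℕ → ℝ}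
    (ha : ∀ j ∈ Finset.Icc 1 N, a j ∈ Set.Ioo (lam (2 * j - 1)) (lam (2 * j)))
    (h : ∀ j ∈ Finset.Icc 1 N, S.eval (a j) = 0) : S = 0 := by
  have hapos : ∀ j ∈ Finset.Icc 1 N, 0 < a j := fun j hj =>
    (gap_pos hpos hmono hj).1.trans (ha j hj).1
  have hmonoa : StrictMonoOn a (Finset.Icc 1 N : Finset ℕ) := by
    intro i hi j hj hij
    have hi' := ha i hi
    have hj' := ha j hj
    rw [Finset.mem_coe, Finset.mem_Icc] at hi hj
    exact hi'.2.trans ((lam_le hmono (by omega) (by omega) (by omega)).trans_lt hj'.1)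
  set s : Finset ℝ := insert 0 ((Finset.Icc 1 N).image a ∪ (Finset.Icc 1 N).image fun j => -a j)
  have hcard : s.card = 2 * N + 1 := by
    rw [Finset.card_insert_of_notMem, Finset.card_union_of_disjoint,
      Finset.card_image_of_injOn hmonoa.injOn, Finset.card_image_of_injOn
        fun i hi j hj hij => hmonoa.injOn hi hj (neg_injective hij)]
    · simp
      ring
    · rw [Finset.disjoint_left]
      intro y hy hy'
      obtain ⟨i, hi, rfl⟩ := Finset.mem_image.1 hy
      obtain ⟨k, hk, hik⟩ := Finset.mem_image.1 hy'
      linarith [hapos i hi, hapos k hk]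
    · intro h0
      rcases Finset.mem_union.1 h0 with h0 | h0
      · obtain ⟨i, hi, h0⟩ := Finset.mem_image.1 h0
        linarith [hapos i hi]
      · obtain ⟨i, hi, h0⟩ := Finset.mem_image.1 h0
        linarith [hapos i hi]
  refine eq_zero_of_natDegree_lt_card_of_eval_eq_zero' S s (fun y hy => ?_) (by omega)
  rcases Finset.mem_insert.1 hy with rfl | hy
  · have := eval_neg_of_odd hS 0
    rw [neg_zero] at this
    linarith
  · rcases Finset.mem_union.1 hy with hy | hy
    · obtain ⟨i, hi, rfl⟩ := Finset.mem_image.1 hy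
      exact h i hi
    · obtain ⟨i, hi, rfl⟩ := Finset.mem_image.1 hy
      rw [eval_neg_of_odd hS, h i hi, neg_zero]

theorem eq_zero_of_odd_of_gapIntegral (hpos : 0 < lam 1)
    (hmono : StrictMonoOn lam (Set.Icc 1 (2 * N + 1))) (hS : S.comp (-X) = -S)
    (hdeg : S.natDegree ≤ 2 * N) (h : ∀ j ∈ Finset.Icc 1 N, gapIntegral N lam j S = 0) :
    S = 0 := by
  choose! a ha ha0 using fun j hj => exists_eval_eq_zero_of_gapIntegral hpos hmono hj (h j hj)
  exact eq_zero_of_odd_of_eval_gap hpos hmono hS hdeg ha ha0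

theorem density_add (S T : ℝ[X]) (z : ℂ) :
    density N lam (S + T) z = density N lam S z + density N lam T z := by
  simp only [density, map_add]
  ring

theorem density_smul (c : ℝ) (S : ℝ[X]) (z : ℂ) :
    density N lam (c • S) z = c * density N lam S z := by
  simp only [density, map_smul, Complex.real_smul]
  ring

theorem gapIntegral_add (hpos : 0 < lam 1) (hmono : StrictMonoOn lam (Set.Icc 1 (2 * N + 1)))
    (j : ℕ) (S T : ℝ[X]) :
    gapIntegral N lam j (S + T) = gapIntegral N lam j S + gapIntegral N lam j T := by
  have hint : ∀ S, IntervalIntegrable (fun x : ℝ => (density N lam S x).im) volume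
      (lam (2 * j - 1)) (lam (2 * j)) := fun S => intervalIntegrable_of_locallyIntegrable
    (locallyIntegrable_im (locallyIntegrable_density hpos hmono S)) _ _
  simp only [gapIntegral, density_add, Complex.add_im]
  exact intervalIntegral.integral_add (hint S) (hint T)

theorem gapIntegral_smul (j : ℕ) (c : ℝ) (S : ℝ[X]) :
    gapIntegral N lam j (c • S) = c * gapIntegral N lam j S := by
  simp only [gapIntegral, density_smul, Complex.im_ofReal_mul]
  exact intervalIntegral.integral_const_mul _ _

/-- The odd polynomial of degree less than `2 N` with the given coefficients. -/
noncomputable def oddPolynomial (N : ℕ) : (Fin N → ℝ) →ₗ[ℝ] ℝ[X] :=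
  Fintype.linearCombination ℝ fun i : Fin N => X ^ (2 * (i : ℕ) + 1)

theorem odd_X_pow {R : Type*} [CommRing R] (n : ℕ) :
    ((X : R[X]) ^ (2 * n + 1)).comp (-X) = -X ^ (2 * n + 1) := by
  simp [(odd_two_mul_add_one n).neg_pow]

theorem oddPolynomial_comp_neg (c : Fin N → ℝ) :
    (oddPolynomial N c).comp (-X) = -oddPolynomial N c := by
  simp only [oddPolynomial, Fintype.linearCombination_apply, Polynomial.sum_comp, smul_comp, odd_X_pow,
    smul_neg, Finset.sum_neg_distrib]

theorem natDegree_oddPolynomial_le (c : Fin N → ℝ) : (oddPolynomial N c).natDegree ≤ 2 * N := by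
  rw [oddPolynomial, Fintype.linearCombination_apply]
  refine natDegree_sum_le_of_forall_le _ _ fun i _ => (natDegree_smul_le _ _).trans ?_
  rw [natDegree_X_pow]
  omega

theorem oddPolynomial_injective : Function.Injective (oddPolynomial N) := by
  intro c d h
  funext i
  have := congrArg (fun p => coeff p (2 * (i : ℕ) + 1)) h
  simpa [oddPolynomial, Fintype.linearCombination_apply, finsetSum_coeff, coeff_X_pow,
    Fin.val_inj] using this

/-- There are `N` gap conditions and `N` free odd coefficients. The linear map between them is
injective by `eq_zero_of_odd_of_gapIntegral`, hence surjective. -/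
theorem exists_gapIntegral_add_oddPolynomial_eq_zero (hpos : 0 < lam 1)
    (hmono : StrictMonoOn lam (Set.Icc 1 (2 * N + 1))) (S : ℝ[X]) :
    ∃ c : Fin N → ℝ, ∀ j ∈ Finset.Icc 1 N, gapIntegral N lam j (S + oddPolynomial N c) = 0 := by
  let L : (Fin N → ℝ) →ₗ[ℝ] (Fin N → ℝ) :=
    { toFun := fun c i => gapIntegral N lam (i + 1) (oddPolynomial N c)
      map_add' := fun c d => by
        funext i
        simp [gapIntegral_add hpos hmono]
      map_smul' := fun r c => by
        funext i
        simp [gapIntegral_smul] }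
  have hmem : ∀ j ∈ Finset.Icc 1 N, ∃ i : Fin N, j = i + 1 := fun j hj => by
    rw [Finset.mem_Icc] at hj
    exact ⟨⟨j - 1, by omega⟩, by simp; omega⟩
  have hinj : Function.Injective L := by
    rw [← LinearMap.ker_eq_bot, LinearMap.ker_eq_bot']
    intro c hc
    refine oddPolynomial_injective ?_
    rw [map_zero]
    refine eq_zero_of_odd_of_gapIntegral hpos hmono (oddPolynomial_comp_neg c)
      (natDegree_oddPolynomial_le c) fun j hj => ?_
    obtain ⟨i, rfl⟩ := hmem j hj
    exact congrFun hc i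
  obtain ⟨c, hc⟩ := LinearMap.injective_iff_surjective.1 hinj
    fun i => -gapIntegral N lam (i + 1) S
  refine ⟨c, fun j hj => ?_⟩
  obtain ⟨i, rfl⟩ := hmem j hj
  have := congrFun hc i
  rw [gapIntegral_add hpos hmono]
  change gapIntegral N lam (i + 1) (oddPolynomial N c) = _ at this
  linarith

theorem integral_density_gap (hpos : 0 < lam 1)
    (hmono : StrictMonoOn lam (Set.Icc 1 (2 * N + 1))) (hj : j ∈ Finset.Icc 1 N) (S : ℝ[X]) :
    ∫ x in (lam (2 * j - 1))..(lam (2 * j)), density N lam S (x : ℂ) =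
      Complex.I * gapIntegral N lam j S := by
  rw [gapIntegral, ← intervalIntegral.integral_ofReal, ← intervalIntegral.integral_const_mul]
  have hlt := (gap_pos hpos hmono hj).2
  rw [intervalIntegral.integral_of_le hlt.le, intervalIntegral.integral_of_le hlt.le,
    integral_Ioc_eq_integral_Ioo, integral_Ioc_eq_integral_Ioo]
  refine setIntegral_congr_fun measurableSet_Ioo fun x hx => ?_
  have := density_re_of_notMem hpos hmono S (notMem_bands_of_mem_gap hpos hmono hj hx)
  exact Complex.ext (by simpa using this) (by simp)

/-- The integrand is even and vanishes on the bands. For `η` in a band, `[0, η]` contains each gap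
entirely or not at all up to endpoints, so the gap conditions suffice. This is where they enter the
dispersion relation. -/
theorem integral_density_im_of_mem_bandsPos (hpos : 0 < lam 1)
    (hmono : StrictMonoOn lam (Set.Icc 1 (2 * N + 1))) (hS : S.comp (-X) = -S)
    (h : ∀ j ∈ Finset.Icc 1 N, gapIntegral N lam j S = 0) {η : ℝ} (hη : η ∈ bandsPos N lam) :
    ∫ x in (-η)..η, (density N lam S x).im = 0 := by
  set f : ℝ → ℝ := fun x => (density N lam S x).im with hf_def
  have hint := intervalIntegrable_of_locallyIntegrable
    (locallyIntegrable_im (locallyIntegrable_density hpos hmono S))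
  have heven : ∀ x, f (-x) = f x := fun x => by
    by_cases hx : x ∈ bands N lam
    · simp only [hf_def]
      rw [density_neg_of_mem hpos hmono hS hx, Complex.neg_im, density_im_of_mem hpos hmono S hx,
        neg_zero]
    · simp only [hf_def]
      rw [density_neg_of_notMem hpos hmono hS hx]
  have hband : ∀ a b : ℝ, a ≤ b → Set.Icc a b ⊆ bandsPos N lam → ∫ x in a..b, f x = 0 := by
    intro a b hab hsub
    rw [intervalIntegral.integral_congr (g := fun _ => (0 : ℝ)), intervalIntegral.integral_zero]
    intro x hx
    rw [Set.uIcc_of_le hab] at hx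
    exact density_im_of_mem hpos hmono S (Or.inl (hsub hx))
  have hband_zero : ∀ b ≤ lam 1, Set.Icc 0 b ⊆ bandsPos N lam := fun b hb x hx =>
    mem_bandsPos.2 (Or.inl ⟨hx.1, hx.2.trans hb⟩)
  have hband_pos : ∀ k ∈ Finset.Icc 1 N, ∀ b ≤ lam (2 * k + 1),
      Set.Icc (lam (2 * k)) b ⊆ bandsPos N lam := fun k hk b hb x hx =>
    mem_bandsPos.2 (Or.inr ⟨k, hk, hx.1, hx.2.trans hb⟩)
  have hodd : ∀ k ≤ N, ∫ x in (0 : ℝ)..lam (2 * k + 1), f x = 0 := by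
    intro k
    induction k with
    | zero => exact fun _ => hband _ _ hpos.le (hband_zero _ le_rfl)
    | succ k ih =>
      intro hk
      have hmem : k + 1 ∈ Finset.Icc 1 N := Finset.mem_Icc.2 ⟨by omega, hk⟩
      have hgap := h (k + 1) hmem
      rw [gapIntegral, show 2 * (k + 1) - 1 = 2 * k + 1 by omega] at hgap
      have hb := hband (lam (2 * (k + 1))) (lam (2 * (k + 1) + 1))
        (lam_le hmono (by omega) (by omega) (by omega)) (hband_pos _ hmem _ le_rfl)
      rw [← intervalIntegral.integral_add_adjacent_intervals (hint 0 (lam (2 * (k + 1))))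
        (hint _ _), ← intervalIntegral.integral_add_adjacent_intervals (hint 0 (lam (2 * k + 1)))
        (hint _ _), ih (by omega), hgap, hb]
      simp
  have hzero : ∫ x in (0 : ℝ)..η, f x = 0 := by
    rcases mem_bandsPos.1 hη with h' | ⟨k, hk, h'⟩
    · exact hband _ _ h'.1 (hband_zero _ h'.2)
    · have hk' := Finset.mem_Icc.1 hk
      -- Gap `k` starts where band `k - 1` ends (the central band if `k = 1`), at `λ_{2k-1}`.
      have h1 := hodd (k - 1) (by omega)
      rw [show 2 * (k - 1) + 1 = 2 * k - 1 by omega] at h1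
      rw [← intervalIntegral.integral_add_adjacent_intervals (hint 0 (lam (2 * k))) (hint _ _),
        ← intervalIntegral.integral_add_adjacent_intervals (hint 0 (lam (2 * k - 1))) (hint _ _),
        h1, hband _ _ h'.1 (hband_pos k hk _ h'.2)]
      have := h k hk
      rw [gapIntegral] at this
      simp [this]
  have hneg : ∫ x in (-η)..0, f x = ∫ x in (0 : ℝ)..η, f x := by
    have := intervalIntegral.integral_comp_neg (a := 0) (b := η) f
    rw [neg_zero] at this
    rw [← this]
    exact intervalIntegral.integral_congr fun x _ => heven x
  rw [← intervalIntegral.integral_add_adjacent_intervals (hint (-η) 0) (hint 0 η), hneg, hzero,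
    add_zero]

end

/-! ### Complex numerators: uniqueness and existence of `P` and `Q` -/

theorem tendsto_eval_div_pow {p : ℂ[X]} {n : ℕ} (hp : p.natDegree ≤ n) :
    Tendsto (fun z : ℂ => p.eval z / z ^ n) (Bornology.cobounded ℂ) (𝓝 (p.coeff n)) := by
  have h : Tendsto (fun z : ℂ => (∑ i ∈ Finset.range n, p.coeff i * (z⁻¹) ^ (n - i)) + p.coeff n)
      (Bornology.cobounded ℂ) (𝓝 ((∑ i ∈ Finset.range n, p.coeff i * 0 ^ (n - i)) + p.coeff n)) :=
    (tendsto_finsetSum _ fun i _ => (tendsto_inv₀_cobounded.pow _).const_mul _).add_const _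
  have h0 : ∑ i ∈ Finset.range n, p.coeff i * 0 ^ (n - i) = 0 :=
    Finset.sum_eq_zero fun i hi => by
      rw [Finset.mem_range] at hi
      rw [zero_pow (by omega), mul_zero]
  rw [h0, zero_add] at h
  refine h.congr' ?_
  filter_upwards [Bornology.eventually_ne_cobounded (0 : ℂ)] with z hz
  rw [eval_eq_sum_range' (show p.natDegree < n + 1 by omega), Finset.sum_range_succ, add_div,
    mul_div_cancel_right₀ _ (pow_ne_zero n hz), Finset.sum_div]
  congr 1
  refine Finset.sum_congr rfl fun i hi => ?_
  rw [Finset.mem_range] at hi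
  rw [mul_div_assoc, inv_pow, ← pow_sub_mul_pow z hi.le]
  field_simp

theorem odd_iff_coeff {R : Type*} [CommRing R] {p : R[X]} :
    p.comp (-X) = -p ↔ ∀ n, p.coeff n * (-1) ^ n = -p.coeff n := by
  rw [Polynomial.ext_iff]
  refine forall_congr' fun n => ?_
  rw [show (-X : R[X]) = C (-1) * X by simp, comp_C_mul_X_coeff, coeff_neg]

theorem coeff_eq_zero_of_odd {p : ℂ[X]} (hp : p.comp (-X) = -p) {n : ℕ} (hn : Even n) :
    p.coeff n = 0 := by
  have := odd_iff_coeff.1 hp n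
  rw [hn.neg_one_pow, mul_one] at this
  exact self_eq_neg.1 this

theorem odd_sub {R : Type*} [CommRing R] {p q : R[X]} (hp : p.comp (-X) = -p)
    (hq : q.comp (-X) = -q) : (p - q).comp (-X) = -(p - q) := by
  rw [sub_comp, hp, hq]
  ring

theorem odd_map {p : ℝ[X]} (hp : p.comp (-X) = -p) :
    (p.map (algebraMap ℝ ℂ)).comp (-X) = -p.map (algebraMap ℝ ℂ) := by
  have := congrArg (Polynomial.map (algebraMap ℝ ℂ)) hp
  simpa [Polynomial.map_comp] using this

theorem eval_map_ofReal (S : ℝ[X]) (z : ℂ) : (S.map (algebraMap ℝ ℂ)).eval z = aeval z S :=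
  eval_map_algebraMap S z

/-- Uniqueness is claimed among complex polynomials, while the zero count in the gaps needs real
ones; this splits the coefficients into real and imaginary parts. -/
theorem exists_odd_re_im {D : ℂ[X]} {n : ℕ} (hD : D.comp (-X) = -D) (hdeg : D.natDegree ≤ n) :
    ∃ S T : ℝ[X], S.comp (-X) = -S ∧ T.comp (-X) = -T ∧ S.natDegree ≤ n ∧ T.natDegree ≤ n ∧
      D = S.map (algebraMap ℝ ℂ) + C Complex.I * T.map (algebraMap ℝ ℂ) := by
  have hsum : ∀ (f : ℂ → ℝ), f 0 = 0 → ∀ i,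
      (∑ k ∈ Finset.range (n + 1), monomial k (f (D.coeff k))).coeff i = f (D.coeff i) := by
    intro f hf i
    simp only [finsetSum_coeff, coeff_monomial, Finset.sum_ite_eq', Finset.mem_range]
    split_ifs with h
    · rfl
    · rw [coeff_eq_zero_of_natDegree_lt (by omega), hf]
  have hdeg' : ∀ f : ℂ → ℝ,
      (∑ k ∈ Finset.range (n + 1), monomial k (f (D.coeff k))).natDegree ≤ n := fun f =>
    natDegree_sum_le_of_forall_le _ _ fun i hi =>
      (natDegree_monomial_le _).trans (by rw [Finset.mem_range] at hi; omega)
  rw [odd_iff_coeff] at hD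
  refine ⟨_, _, odd_iff_coeff.2 fun i => ?_, odd_iff_coeff.2 fun i => ?_, hdeg' Complex.re,
    hdeg' Complex.im, ?_⟩
  · rw [hsum Complex.re Complex.zero_re, ← Complex.neg_re, ← hD i]
    -- The powers of `-1` in `ℂ` and in `ℝ` agree; the two mixed cases are contradictory.
    rcases neg_one_pow_eq_or ℂ i with h | h <;> rcases neg_one_pow_eq_or ℝ i with h' | h' <;>
      [simp [h, h']; skip; skip; simp [h, h']]
    all_goals
      have := congrArg Complex.re h
      rw [← Complex.ofReal_one, ← Complex.ofReal_neg, ← Complex.ofReal_pow, Complex.ofReal_re,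
        h'] at this
      norm_num at this
  · rw [hsum Complex.im Complex.zero_im, ← Complex.neg_im, ← hD i]
    rcases neg_one_pow_eq_or ℂ i with h | h <;> rcases neg_one_pow_eq_or ℝ i with h' | h' <;>
      [simp [h, h']; skip; skip; simp [h, h']]
    all_goals
      have := congrArg Complex.re h
      rw [← Complex.ofReal_one, ← Complex.ofReal_neg, ← Complex.ofReal_pow, Complex.ofReal_re,
        h'] at this
      norm_num at this
  · ext1 i
    rw [coeff_add, coeff_C_mul, coeff_map, coeff_map, hsum Complex.re Complex.zero_re,
      hsum Complex.im Complex.zero_im, mul_comm]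
    exact (Complex.re_add_im _).symm

section

variable {N : ℕ} {lam : ℕ → ℝ}

/-- The differential `i P(z) / R(z)` with a complex numerator. -/
noncomputable def complexDensity (N : ℕ) (lam : ℕ → ℝ) (P : ℂ[X]) (z : ℂ) : ℂ :=
  Complex.I * P.eval z / root N lam z

theorem dp_eq (P : ℂ[X]) : dp N lam P = fun z => (1 / Real.pi : ℂ) * complexDensity N lam P z := by
  funext z
  simp only [dp, complexDensity]
  rw [div_mul_div_comm, one_mul]

theorem dq_eq (Q : ℂ[X]) : dq N lam Q = fun z => (12 / Real.pi : ℂ) * complexDensity N lam Q z := by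
  funext z
  simp only [dq, complexDensity]
  rw [div_mul_div_comm, mul_assoc]

theorem complexDensity_map (S : ℝ[X]) (z : ℂ) :
    complexDensity N lam (S.map (algebraMap ℝ ℂ)) z = density N lam S z := by
  rw [complexDensity, density, eval_map_ofReal]

theorem gapIntegralsVanish_const_mul {c : ℂ} (hc : c ≠ 0) {f : ℂ → ℂ} :
    GapIntegralsVanish N lam (fun z => c * f z) ↔ GapIntegralsVanish N lam f := by
  simp [GapIntegralsVanish, hc]

theorem gapIntegralsVanish_dp {P : ℂ[X]} :
    GapIntegralsVanish N lam (dp N lam P) ↔ GapIntegralsVanish N lam (complexDensity N lam P) := by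
  rw [dp_eq]
  exact gapIntegralsVanish_const_mul (by simp)

theorem gapIntegralsVanish_dq {Q : ℂ[X]} :
    GapIntegralsVanish N lam (dq N lam Q) ↔ GapIntegralsVanish N lam (complexDensity N lam Q) := by
  rw [dq_eq]
  exact gapIntegralsVanish_const_mul (by simp)

theorem gapIntegralsVanish_complexDensity_map (hpos : 0 < lam 1)
    (hmono : StrictMonoOn lam (Set.Icc 1 (2 * N + 1))) {S : ℝ[X]} :
    GapIntegralsVanish N lam (complexDensity N lam (S.map (algebraMap ℝ ℂ))) ↔
      ∀ j ∈ Finset.Icc 1 N, gapIntegral N lam j S = 0 := by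
  refine forall₂_congr fun j hj => ?_
  simp only [complexDensity_map, integral_density_gap hpos hmono hj]
  simp

theorem intervalIntegrable_complexDensity (hpos : 0 < lam 1)
    (hmono : StrictMonoOn lam (Set.Icc 1 (2 * N + 1))) (P : ℂ[X]) (a b : ℝ) :
    IntervalIntegrable (fun x : ℝ => complexDensity N lam P x) volume a b := by
  have h := intervalIntegrable_of_locallyIntegrable (locallyIntegrable_density hpos hmono 1) a b
  refine (h.continuousOn_mul (g := fun x : ℝ => P.eval (x : ℂ)) (by fun_prop)).congr ?_
  intro x _
  simp only [density, complexDensity, map_one]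
  ring

/-- Write the difference as `S + i T` with real `S`, `T`. Its gap integrals are `i` times that of
`S` minus that of `T`, so both real families vanish. -/
theorem eq_of_odd_of_gapIntegralsVanish (hpos : 0 < lam 1)
    (hmono : StrictMonoOn lam (Set.Icc 1 (2 * N + 1))) {P Q : ℂ[X]} (hP : P.comp (-X) = -P)
    (hQ : Q.comp (-X) = -Q) (hdeg : (P - Q).natDegree ≤ 2 * N)
    (hP' : GapIntegralsVanish N lam (complexDensity N lam P))
    (hQ' : GapIntegralsVanish N lam (complexDensity N lam Q)) : P = Q := by
  obtain ⟨S, T, hS, hT, hSd, hTd, hD⟩ := exists_odd_re_im (odd_sub hP hQ) hdeg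
  have hz : ∀ z, complexDensity N lam P z - complexDensity N lam Q z =
      density N lam S z + Complex.I * density N lam T z := fun z => by
    rw [← complexDensity_map, ← complexDensity_map]
    have := congrArg (eval z) hD
    rw [eval_sub, eval_add, eval_mul, eval_C] at this
    simp only [complexDensity, ← sub_div, ← mul_sub, this]
    ring
  have hgap : ∀ j ∈ Finset.Icc 1 N, gapIntegral N lam j S = 0 ∧ gapIntegral N lam j T = 0 := by
    intro j hj
    have hint := fun S => intervalIntegrable_of_locallyIntegrable
      (locallyIntegrable_density hpos hmono S) (lam (2 * j - 1)) (lam (2 * j))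
    have h1 := intervalIntegral.integral_sub
      (intervalIntegrable_complexDensity hpos hmono P (lam (2 * j - 1)) (lam (2 * j)))
      (intervalIntegrable_complexDensity hpos hmono Q (lam (2 * j - 1)) (lam (2 * j)))
    rw [hP' j hj, hQ' j hj, sub_zero] at h1
    simp only [hz] at h1
    rw [intervalIntegral.integral_add (hint S) ((hint T).const_mul _),
      intervalIntegral.integral_const_mul, integral_density_gap hpos hmono hj,
      integral_density_gap hpos hmono hj] at h1
    have hre := congrArg Complex.re h1
    have him := congrArg Complex.im h1
    simp at hre him
    exact ⟨him, hre⟩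
  rw [eq_zero_of_odd_of_gapIntegral hpos hmono hS hSd fun j hj => (hgap j hj).1,
    eq_zero_of_odd_of_gapIntegral hpos hmono hT hTd fun j hj => (hgap j hj).2] at hD
  simpa [sub_eq_zero] using hD

theorem tendsto_eval_div_root (lam : ℕ → ℝ) {D : ℂ[X]} (hD : D.natDegree ≤ 2 * N + 1) :
    Tendsto (fun z => D.eval z / root N lam z) (Bornology.cobounded ℂ)
      (𝓝 (D.coeff (2 * N + 1))) := by
  have h := (tendsto_eval_div_pow hD).div (tendsto_root_div N lam) one_ne_zero
  rw [div_one] at h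
  refine h.congr' ?_
  filter_upwards [Bornology.eventually_ne_cobounded (0 : ℂ)] with z hz
  rw [Pi.div_apply, div_div_div_cancel_right₀ (pow_ne_zero _ hz)]

theorem natDegree_sub_le_of_monic {R : Type*} [CommRing R] {n : ℕ} {P Q : R[X]} (hP : P.Monic)
    (hP' : P.natDegree = n + 1) (hQ : Q.Monic) (hQ' : Q.natDegree = n + 1) :
    (P - Q).natDegree ≤ n := by
  rw [natDegree_le_iff_coeff_eq_zero]
  intro m hm
  rcases Nat.lt_or_ge (n + 1) m with h | h
  · rw [coeff_sub, coeff_eq_zero_of_natDegree_lt (by omega),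
      coeff_eq_zero_of_natDegree_lt (by omega), sub_zero]
  · obtain rfl : m = n + 1 := by omega
    have h1 := hP.coeff_natDegree
    have h2 := hQ.coeff_natDegree
    rw [hP'] at h1
    rw [hQ'] at h2
    rw [coeff_sub, h1, h2, sub_self]

theorem IsNumeratorP.unique (hpos : 0 < lam 1)
    (hmono : StrictMonoOn lam (Set.Icc 1 (2 * N + 1))) {P Q : ℂ[X]} (hP : IsNumeratorP N lam P)
    (hQ : IsNumeratorP N lam Q) : P = Q :=
  eq_of_odd_of_gapIntegralsVanish hpos hmono hP.1.2.2 hQ.1.2.2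
    (natDegree_sub_le_of_monic hP.1.1 hP.1.2.1 hQ.1.1 hQ.1.2.1)
    (gapIntegralsVanish_dp.1 hP.2) (gapIntegralsVanish_dp.1 hQ.2)

/-- The difference has degree at most `2 N + 2`. Oddness removes the coefficient of degree `2 N +
2`. The one of degree `2 N + 1` is the limit of the difference over `R`, which is zero because
neither differential has a constant term at infinity. -/
theorem IsNumeratorQ.unique (hpos : 0 < lam 1)
    (hmono : StrictMonoOn lam (Set.Icc 1 (2 * N + 1))) {P Q : ℂ[X]} (hP : IsNumeratorQ N lam P)
    (hQ : IsNumeratorQ N lam Q) : P = Q := by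
  refine eq_of_odd_of_gapIntegralsVanish hpos hmono hP.1.2.2 hQ.1.2.2 ?_
    (gapIntegralsVanish_dq.1 hP.2.1) (gapIntegralsVanish_dq.1 hQ.2.1)
  have hodd := odd_sub hP.1.2.2 hQ.1.2.2
  have hdeg : (P - Q).natDegree ≤ 2 * (N + 1) :=
    natDegree_sub_le_of_monic hP.1.1 hP.1.2.1 hQ.1.1 hQ.1.2.1
  have hdeg' : (P - Q).natDegree ≤ 2 * N + 1 := by
    rw [natDegree_le_iff_coeff_eq_zero]
    intro n hn
    rcases Nat.lt_or_ge (2 * (N + 1)) n with h | h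
    · exact coeff_eq_zero_of_natDegree_lt (by omega)
    · obtain rfl : n = 2 * (N + 1) := by omega
      exact coeff_eq_zero_of_odd hodd (even_two_mul _)
  have hpi : (12 / Real.pi : ℂ) ≠ 0 := by simp
  have hlim : Tendsto (fun z => (P - Q).eval z / root N lam z) (Bornology.cobounded ℂ) (𝓝 0) := by
    have h := (hP.2.2.sub hQ.2.2).const_mul ((12 / Real.pi : ℂ)⁻¹ * Complex.I⁻¹)
    rw [sub_zero, mul_zero] at h
    refine h.congr fun z => ?_
    simp only [dq_eq, complexDensity, eval_sub]
    field_simp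
    ring
  have hcoeff := tendsto_nhds_unique (tendsto_eval_div_root lam hdeg') hlim
  rw [natDegree_le_iff_coeff_eq_zero]
  intro n hn
  rcases Nat.lt_or_ge (2 * N + 1) n with h | h
  · exact coeff_eq_zero_of_natDegree_lt (by omega)
  · obtain rfl : n = 2 * N + 1 := by omega
    exact hcoeff

theorem isOddMonic_map {d : ℕ} {S : ℝ[X]} (h1 : S.Monic) (h2 : S.natDegree = d)
    (h3 : S.comp (-X) = -S) : IsOddMonic d (S.map (algebraMap ℝ ℂ)) :=
  ⟨h1.map _, by rw [h1.natDegree_map, h2], odd_map h3⟩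

theorem exists_real_numeratorP (hpos : 0 < lam 1)
    (hmono : StrictMonoOn lam (Set.Icc 1 (2 * N + 1))) :
    ∃ S : ℝ[X], S.Monic ∧ S.natDegree = 2 * N + 1 ∧ S.comp (-X) = -S ∧
      ∀ j ∈ Finset.Icc 1 N, gapIntegral N lam j S = 0 := by
  obtain ⟨c, hc⟩ := exists_gapIntegral_add_oddPolynomial_eq_zero hpos hmono (X ^ (2 * N + 1))
  have hdeg : (oddPolynomial N c).degree < (2 * N + 1 : ℕ) :=
    (degree_le_of_natDegree_le (natDegree_oddPolynomial_le c)).trans_lt (by exact_mod_cast (by omega))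
  refine ⟨_, monic_X_pow_add hdeg, ?_, ?_, hc⟩
  · rw [natDegree_add_eq_left_of_degree_lt (by rwa [degree_X_pow]), natDegree_X_pow]
  · rw [add_comp, odd_X_pow, oddPolynomial_comp_neg, neg_add]

theorem isNumeratorP_map (hpos : 0 < lam 1) (hmono : StrictMonoOn lam (Set.Icc 1 (2 * N + 1)))
    {S : ℝ[X]} (h1 : S.Monic) (h2 : S.natDegree = 2 * N + 1) (h3 : S.comp (-X) = -S)
    (h4 : ∀ j ∈ Finset.Icc 1 N, gapIntegral N lam j S = 0) :
    IsNumeratorP N lam (S.map (algebraMap ℝ ℂ)) :=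
  ⟨isOddMonic_map h1 h2 h3, gapIntegralsVanish_dp.2
    ((gapIntegralsVanish_complexDensity_map hpos hmono).2 h4)⟩

theorem tendsto_sq_mul_one_sub_prod (s : Finset ℕ) (a : ℕ → ℂ) :
    Tendsto (fun z : ℂ => z ^ 2 * (1 - ∏ j ∈ s, (1 - a j * (z⁻¹) ^ 2))) (Bornology.cobounded ℂ)
      (𝓝 (∑ j ∈ s, a j)) := by
  induction s using Finset.induction_on with
  | empty => simp
  | insert i s hi ih =>
    have hprod : Tendsto (fun z : ℂ => ∏ j ∈ s, (1 - a j * (z⁻¹) ^ 2)) (Bornology.cobounded ℂ)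
        (𝓝 1) := by
      have := tendsto_finsetProd s fun j _ =>
        ((tendsto_inv₀_cobounded (α := ℂ)).pow 2 |>.const_mul (a j)).const_sub 1
      simpa using this
    have h := (hprod.const_mul (a i)).add ih
    rw [mul_one] at h
    rw [Finset.sum_insert hi]
    refine h.congr' ?_
    filter_upwards [Bornology.eventually_ne_cobounded (0 : ℂ)] with z hz
    rw [Finset.prod_insert hi]
    have : z ^ 2 * (z⁻¹) ^ 2 = 1 := by rw [← mul_pow, mul_inv_cancel₀ hz, one_pow]
    linear_combination (-a i * ∏ j ∈ s, (1 - a j * (z⁻¹) ^ 2)) * this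

/-- The second coefficient of the expansion of `R` at infinity. -/
theorem tendsto_sq_mul_one_sub_root (N : ℕ) (lam : ℕ → ℝ) :
    Tendsto (fun z : ℂ => z ^ 2 * (1 - root N lam z / z ^ (2 * N + 1))) (Bornology.cobounded ℂ)
      (𝓝 ((∑ j ∈ Finset.Icc 1 (2 * N + 1), (lam j : ℂ) ^ 2) / 2)) := by
  have hρ := tendsto_root_div N lam
  have h2 : Tendsto (fun z : ℂ => 1 + root N lam z / z ^ (2 * N + 1)) (Bornology.cobounded ℂ)
      (𝓝 2) := by
    have := hρ.const_add 1
    rwa [one_add_one_eq_two] at this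
  -- With `ρ = R / z ^ (2 N + 1)`, write `1 - ρ = (1 - ρ²) / (1 + ρ)`; here `ρ²` is the explicit
  -- product of the `1 - λ_j² / z²`, and `1 + ρ → 2`.
  refine ((tendsto_sq_mul_one_sub_prod (Finset.Icc 1 (2 * N + 1)) fun j => (lam j : ℂ) ^ 2).div h2
    two_ne_zero).congr' ?_
  filter_upwards [Bornology.eventually_ne_cobounded (0 : ℂ), h2.eventually_ne two_ne_zero]
    with z hz hz2
  have hprod : ∏ j ∈ Finset.Icc 1 (2 * N + 1), (1 - (lam j : ℂ) ^ 2 * (z⁻¹) ^ 2) =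
      (root N lam z / z ^ (2 * N + 1)) ^ 2 := by
    rw [div_pow, root_sq, ← pow_mul, mul_comm (2 * N + 1) 2, pow_mul,
      show (z ^ 2) ^ (2 * N + 1) = ∏ j ∈ Finset.Icc 1 (2 * N + 1), z ^ 2 by simp,
      ← Finset.prod_div_distrib]
    refine Finset.prod_congr rfl fun j _ => ?_
    field_simp
  rw [Pi.div_apply, hprod, div_eq_iff hz2]
  ring

theorem exists_real_numeratorQ (hpos : 0 < lam 1)
    (hmono : StrictMonoOn lam (Set.Icc 1 (2 * N + 1))) :
    ∃ S : ℝ[X], S.comp (-X) = -S ∧ (∀ j ∈ Finset.Icc 1 N, gapIntegral N lam j S = 0) ∧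
      IsNumeratorQ N lam (S.map (algebraMap ℝ ℂ)) := by
  -- Since `R = z ^ (2 N + 1) (1 - ∑ λ_j² / (2 z²) + …)`, the constant term of `Q / R` is `q + ∑
  -- λ_j² / 2`, and this `q` cancels it. The correction `L`, of degree at most `2 N`, does not
  -- affect that term.
  set q : ℝ := -(∑ j ∈ Finset.Icc 1 (2 * N + 1), lam j ^ 2) / 2 with hq
  obtain ⟨c, hc⟩ := exists_gapIntegral_add_oddPolynomial_eq_zero hpos hmono
    (X ^ (2 * N + 3) + q • X ^ (2 * N + 1))
  set L := oddPolynomial N c with hL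
  have hLd : L.natDegree ≤ 2 * N := natDegree_oddPolynomial_le c
  have hdeg : (q • X ^ (2 * N + 1) + L : ℝ[X]).degree < ((2 * N + 3 : ℕ) : WithBot ℕ) := by
    refine (degree_le_of_natDegree_le (n := 2 * N + 1) ((natDegree_add_le _ _).trans
      (max_le ((natDegree_smul_le _ _).trans (natDegree_X_pow_le _)) (by omega)))).trans_lt ?_
    exact_mod_cast (by omega)
  rw [add_assoc] at hc
  have hodd : (X ^ (2 * N + 3) + (q • X ^ (2 * N + 1) + L)).comp (-X) =
      -(X ^ (2 * N + 3) + (q • X ^ (2 * N + 1) + L)) := by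
    rw [add_comp, add_comp, smul_comp, odd_X_pow, oddPolynomial_comp_neg,
      show 2 * N + 3 = 2 * (N + 1) + 1 by ring, odd_X_pow, smul_neg, neg_add, neg_add]
  refine ⟨_, hodd, hc, isOddMonic_map (monic_X_pow_add hdeg) ?_ hodd, gapIntegralsVanish_dq.2
    ((gapIntegralsVanish_complexDensity_map hpos hmono).2 hc), ?_⟩
  · rw [natDegree_add_eq_left_of_degree_lt (by rwa [degree_X_pow]), natDegree_X_pow]
  have hρ := tendsto_root_div N lam
  have h1 := ((tendsto_sq_mul_one_sub_root N lam).const_add (q : ℂ)).div hρ one_ne_zero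
  have hLlim := tendsto_eval_div_root (N := N) lam (D := L.map (algebraMap ℝ ℂ))
    ((natDegree_map_le).trans (by omega))
  rw [coeff_map, coeff_eq_zero_of_natDegree_lt (show L.natDegree < 2 * N + 1 by omega),
    map_zero] at hLlim
  have h2 := (h1.add hLlim).const_mul (12 * Complex.I / Real.pi)
  have h0 : (q : ℂ) + (∑ j ∈ Finset.Icc 1 (2 * N + 1), (lam j : ℂ) ^ 2) / 2 = 0 := by
    rw [hq]
    push_cast
    ring
  rw [h0, zero_div, add_zero, mul_zero] at h2
  refine h2.congr' ?_
  filter_upwards [Bornology.eventually_ne_cobounded (0 : ℂ), hρ.eventually_ne one_ne_zero]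
    with z hz hρz
  have hR : root N lam z ≠ 0 := fun h => hρz (by rw [h, zero_div])
  have hpi : (Real.pi : ℂ) ≠ 0 := by exact_mod_cast Real.pi_ne_zero
  rw [Pi.div_apply, dq, eval_map_ofReal, eval_map_ofReal, map_add, map_add, map_smul, map_pow,
    map_pow, aeval_X, Complex.real_smul]
  field_simp
  ring

end

/-! ### Positivity and assembly of the theorem -/

section

variable {N : ℕ} {lam : ℕ → ℝ} {S : ℝ[X]}

/-- Both sides are odd and monic of degree `2 N + 1` and vanish at the `a j`, so their difference is
zero by the count of zeros. -/
theorem eq_X_mul_prod_of_eval_gap (hpos : 0 < lam 1)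
    (hmono : StrictMonoOn lam (Set.Icc 1 (2 * N + 1))) (h1 : S.Monic)
    (h2 : S.natDegree = 2 * N + 1) (h3 : S.comp (-X) = -S) {a : ℕ → ℝ}
    (ha : ∀ j ∈ Finset.Icc 1 N, a j ∈ Set.Ioo (lam (2 * j - 1)) (lam (2 * j)))
    (h : ∀ j ∈ Finset.Icc 1 N, S.eval (a j) = 0) :
    S = X * ∏ j ∈ Finset.Icc 1 N, (X ^ 2 - C (a j ^ 2)) := by
  set W : ℝ[X] := X * ∏ j ∈ Finset.Icc 1 N, (X ^ 2 - C (a j ^ 2)) with hW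
  have hfac : ∀ j ∈ Finset.Icc 1 N, (X ^ 2 - C (a j ^ 2)).Monic := fun j _ =>
    monic_X_pow_sub_C _ two_ne_zero
  have hWm : W.Monic := monic_X.mul (monic_prod_of_monic _ _ hfac)
  have hWd : W.natDegree = 2 * N + 1 := by
    rw [hW, monic_X.natDegree_mul (monic_prod_of_monic _ _ hfac), natDegree_prod_of_monic _ _ hfac,
      natDegree_X]
    simp only [natDegree_X_pow_sub_C, Finset.sum_const, Nat.card_Icc, smul_eq_mul]
    ring_nf
    omega
  have hWo : W.comp (-X) = -W := by
    simp [hW, mul_comp, prod_comp]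
  have hdeg : (S - W).natDegree ≤ 2 * N := natDegree_sub_le_of_monic h1 h2 hWm hWd
  refine sub_eq_zero.1 (eq_zero_of_odd_of_eval_gap hpos hmono (odd_sub h3 hWo) hdeg ha ?_)
  intro j hj
  rw [eval_sub, h j hj, hW, eval_mul, eval_prod, Finset.prod_eq_zero hj (by simp), mul_zero,
    sub_zero]

theorem prod_eq_ofReal_nonneg {ι : Type*} {s : Finset ι} {F : ι → ℂ}
    (h : ∀ k ∈ s, ∃ r : ℝ, 0 ≤ r ∧ F k = r) : ∃ r : ℝ, 0 ≤ r ∧ ∏ k ∈ s, F k = r := by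
  choose! r h1 h2 using h
  exact ⟨∏ k ∈ s, r k, Finset.prod_nonneg h1, by
    rw [Finset.prod_congr rfl h2, Complex.ofReal_prod]⟩

/-- Match `x² - a_k²` with the root of band `k`, the band just after the gap containing `a_k`. For
`x` in any other band both are nonpositive or both nonnegative, as `x` lies before the gap or after
the band. The one imaginary factor, of the band containing `x`, cancels the `i` in the numerator. At
a branch point the quotient has the default value zero, so endpoints need no exception. -/
theorem density_re_nonneg (hpos : 0 < lam 1) (hmono : StrictMonoOn lam (Set.Icc 1 (2 * N + 1)))
    (h1 : S.Monic) (h2 : S.natDegree = 2 * N + 1) (h3 : S.comp (-X) = -S)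
    (h4 : ∀ j ∈ Finset.Icc 1 N, gapIntegral N lam j S = 0) {x : ℝ} (hx : x ∈ bandsPos N lam) :
    0 ≤ (density N lam S x).re := by
  choose! a ha ha0 using fun j hj => exists_eval_eq_zero_of_gapIntegral hpos hmono hj (h4 j hj)
  have hx0 := nonneg_of_mem_bandsPos hpos hmono hx
  have hpair : ∀ k ∈ Finset.Icc 1 N, 0 < lam (2 * k) ∧ lam (2 * k) < lam (2 * k + 1) ∧ 0 < a k :=
    fun k hk => by
      have hg := gap_pos hpos hmono hk
      have hk' := Finset.mem_Icc.1 hk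
      exact ⟨hg.1.trans hg.2, lam_lt hmono (by omega) (by omega) (by omega),
        hg.1.trans (ha k hk).1⟩
  set F : ℕ → ℂ := fun k => ((x ^ 2 - a k ^ 2 : ℝ) : ℂ) / pairRoot (lam (2 * k)) (lam (2 * k + 1)) x
    with hF
  have hfactor : density N lam S x = Complex.I * x / bandRoot (-lam 1) (lam 1) x *
      ∏ k ∈ Finset.Icc 1 N, F k := by
    rw [density, aeval_ofReal_complex, eq_X_mul_prod_of_eval_gap hpos hmono h1 h2 h3 ha ha0,
      root_eq, hF, Finset.prod_div_distrib, div_mul_div_comm, eval_mul, eval_prod]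
    simp [mul_assoc]
  have hge : ∀ k ∈ Finset.Icc 1 N, lam (2 * k + 1) ≤ x → ∃ r : ℝ, 0 ≤ r ∧ F k = r := by
    intro k hk hkx
    have hp := hpair k hk
    obtain ⟨r, hr, hr', -⟩ := pairRoot_of_ge hp.1 hp.2.1 hkx
    have := (ha k hk).2
    exact ⟨(x ^ 2 - a k ^ 2) / r, div_nonneg (by nlinarith) hr, by simp [hF, hr']⟩
  have hle : ∀ k ∈ Finset.Icc 1 N, x ≤ lam (2 * k - 1) → ∃ r : ℝ, 0 ≤ r ∧ F k = r := by
    intro k hk hkx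
    have hp := hpair k hk
    have hg := gap_pos hpos hmono hk
    obtain ⟨r, hr, hr', -⟩ := pairRoot_of_le hp.1 hp.2.1 hx0 (hkx.trans hg.2.le)
    have := (ha k hk).1
    refine ⟨(a k ^ 2 - x ^ 2) / r, div_nonneg (by nlinarith) hr, ?_⟩
    simp only [hF, hr']
    push_cast
    rw [div_neg, ← neg_div, neg_sub]
  rw [hfactor]
  rcases mem_bandsPos.1 hx with h | ⟨m, hm, h⟩
  · obtain ⟨r, hr, hr'⟩ := prod_eq_ofReal_nonneg fun k (hk : k ∈ Finset.Icc 1 N) =>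
      hle k hk (h.2.trans (by
        have := Finset.mem_Icc.1 hk
        exact lam_le hmono le_rfl (by omega) (by omega)))
    rw [hr', bandRoot_of_mem (by linarith) h.2, mul_div_mul_left _ _ Complex.I_ne_zero,
      ← Complex.ofReal_div, ← Complex.ofReal_mul, Complex.ofReal_re]
    exact mul_nonneg (div_nonneg hx0 (Real.sqrt_nonneg _)) hr
  · have hm' := Finset.mem_Icc.1 hm
    obtain ⟨r, hr, hr'⟩ := prod_eq_ofReal_nonneg fun k (hk : k ∈ (Finset.Icc 1 N).erase m) => by
      have hk1 := Finset.mem_of_mem_erase hk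
      have hk' := Finset.mem_Icc.1 hk1
      rcases lt_or_gt_of_ne (Finset.ne_of_mem_erase hk) with hkm | hkm
      · exact hge k hk1 ((lam_le hmono (by omega) (by omega) (by omega)).trans h.1)
      · exact hle k hk1 (h.2.trans (lam_le hmono (by omega) (by omega) (by omega)))
    have hp := hpair m hm
    obtain ⟨s, hs, hs', -⟩ := pairRoot_of_mem hp.1 h.1 h.2
    have hx1 : lam 1 ≤ x := (lam_le hmono le_rfl (by omega) (by omega)).trans h.1
    have ham := (ha m hm).2
    have e : Complex.I * x / bandRoot (-lam 1) (lam 1) x * ∏ k ∈ Finset.Icc 1 N, F k =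
        ((x / Real.sqrt ((x - -lam 1) * (x - lam 1)) * ((x ^ 2 - a m ^ 2) / s) * r : ℝ) : ℂ) := by
      rw [← Finset.mul_prod_erase _ _ hm, hr', bandRoot_of_ge (by linarith) hx1]
      simp only [hF, hs']
      rw [mul_comm Complex.I (s : ℂ), ← div_div, div_eq_mul_inv _ Complex.I, Complex.inv_I]
      push_cast
      linear_combination (-(x / (Real.sqrt ((x - -lam 1) * (x - lam 1)) : ℂ) *
        (((x : ℂ) ^ 2 - (a m : ℂ) ^ 2) / s) * r)) * Complex.I_sq
    rw [e, Complex.ofReal_re]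
    exact mul_nonneg (mul_nonneg (div_nonneg hx0 (Real.sqrt_nonneg _))
      (div_nonneg (by nlinarith) hs)) hr

theorem integrableOn_bands_density (hpos : 0 < lam 1)
    (hmono : StrictMonoOn lam (Set.Icc 1 (2 * N + 1))) (S : ℝ[X]) :
    IntegrableOn (fun x : ℝ => density N lam S x) (bands N lam) :=
  ((locallyIntegrable_density hpos hmono S).integrableOn_isCompact isCompact_Icc).mono_set
    (bands_subset_Icc hpos hmono)

theorem solvesNDR_density (hpos : 0 < lam 1) (hmono : StrictMonoOn lam (Set.Icc 1 (2 * N + 1)))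
    (hS : S.comp (-X) = -S) {T : ℝ[X]}
    (hT : Tendsto (residual N lam S T) (Bornology.cobounded ℂ) (𝓝 0))
    (hgap : ∀ j ∈ Finset.Icc 1 N, gapIntegral N lam j S = 0) {G : ℝ → ℝ}
    (hG : ∀ η, Real.pi / 2 * ∫ x in (-η)..η, T.eval x = G η) :
    SolvesNDR (bandsPos N lam) (fun _ => 0) G fun x => density N lam S x := by
  intro η hη
  have h := integral_log_mul_density hpos hmono hS hT (nonneg_of_mem_bandsPos hpos hmono hη)
  refine ⟨h.1, ?_⟩
  rw [h.2, intervalIntegral.integral_sub (T.continuous.intervalIntegrable _ _)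
    (intervalIntegrable_of_locallyIntegrable
      (locallyIntegrable_im (locallyIntegrable_density hpos hmono S)) _ _),
    integral_density_im_of_mem_bandsPos hpos hmono hS hgap hη, sub_zero, hG]
  simp

theorem smul_odd {c : ℝ} (hS : S.comp (-X) = -S) : (c • S).comp (-X) = -(c • S) := by
  rw [smul_comp, hS, smul_neg]

theorem gapIntegral_smul_eq_zero {c : ℝ} (hgap : ∀ j ∈ Finset.Icc 1 N, gapIntegral N lam j S = 0) :
    ∀ j ∈ Finset.Icc 1 N, gapIntegral N lam j (c • S) = 0 := fun j hj => by
  rw [gapIntegral_smul, hgap j hj, mul_zero]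

theorem dp_map (S : ℝ[X]) :
    dp N lam (S.map (algebraMap ℝ ℂ)) = density N lam ((1 / Real.pi : ℝ) • S) := by
  funext z
  simp only [dp_eq, density_smul, complexDensity_map]
  push_cast
  ring

theorem dq_map (S : ℝ[X]) :
    dq N lam (S.map (algebraMap ℝ ℂ)) = density N lam ((12 / Real.pi : ℝ) • S) := by
  funext z
  simp only [dq_eq, density_smul, complexDensity_map]
  push_cast
  ring

theorem tendsto_residual_dp (h1 : S.Monic) (h2 : S.natDegree = 2 * N + 1) :
    Tendsto (residual N lam ((1 / Real.pi : ℝ) • S) (C (1 / Real.pi))) (Bornology.cobounded ℂ)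
      (𝓝 0) := by
  have h := tendsto_eval_div_root (N := N) lam (D := S.map (algebraMap ℝ ℂ))
    (by rw [h1.natDegree_map, h2])
  have hc := h1.coeff_natDegree
  rw [h2] at hc
  rw [coeff_map, hc, map_one] at h
  have h' := (h.sub_const 1).const_mul (Complex.I / Real.pi)
  rw [sub_self, mul_zero] at h'
  refine h'.congr fun z => ?_
  rw [residual, density_smul, density, aeval_C, eval_map_ofReal]
  simp only [Complex.coe_algebraMap]
  push_cast
  ring

theorem tendsto_residual_dq
    (h : Tendsto (fun z : ℂ => dq N lam (S.map (algebraMap ℝ ℂ)) z -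
      12 * Complex.I / Real.pi * z ^ 2) (Bornology.cobounded ℂ) (𝓝 0)) :
    Tendsto (residual N lam ((12 / Real.pi : ℝ) • S) (C (12 / Real.pi) * X ^ 2))
      (Bornology.cobounded ℂ) (𝓝 0) := by
  refine h.congr fun z => ?_
  rw [dq_map, residual, map_mul, aeval_C, map_pow, aeval_X]
  simp only [Complex.coe_algebraMap]
  push_cast
  ring

end

end SolitonCondensate

open SolitonCondensate

theorem theorem3p1 (N : ℕ) (lam : ℕ → ℝ) (hpos : 0 < lam 1)
    (hmono : StrictMonoOn lam (Set.Icc 1 (2 * N + 1))) :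
    (∃! P : Polynomial ℂ, SolitonCondensate.IsNumeratorP N lam P) ∧
    (∃! Q : Polynomial ℂ, SolitonCondensate.IsNumeratorQ N lam Q) ∧
    ∀ P Q : Polynomial ℂ,
      SolitonCondensate.IsNumeratorP N lam P → SolitonCondensate.IsNumeratorQ N lam Q →
      ∀ u v : ℝ → ℂ,
        (∀ η : ℝ, u η = SolitonCondensate.dp N lam P (η : ℂ)) →
        (∀ η : ℝ, v η = SolitonCondensate.dq N lam Q (η : ℂ)) →
        -- `u` and `v` are odd and real valued
        (∀ η ∈ SolitonCondensate.bands N lam \ SolitonCondensate.branchPoints N lam,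
          u (-η) = -u η ∧ v (-η) = -v η ∧ (u η).im = 0 ∧ (v η).im = 0) ∧
        -- they solve the Hilbert transform equations
        MeasureTheory.IntegrableOn u (SolitonCondensate.bands N lam) ∧
        MeasureTheory.IntegrableOn v (SolitonCondensate.bands N lam) ∧
        (∀ η ∈ SolitonCondensate.bands N lam \ SolitonCondensate.branchPoints N lam,
          SolitonCondensate.HasHilbertTransform (SolitonCondensate.bands N lam) u η
            (1 / Real.pi) ∧
          SolitonCondensate.HasHilbertTransform (SolitonCondensate.bands N lam) v η
            (12 * (η : ℂ) ^ 2 / Real.pi)) ∧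
        -- they solve the dispersion relations with `σ = 0`
        SolitonCondensate.SolvesNDR (SolitonCondensate.bandsPos N lam) (fun _ => 0)
          (fun η => η) u ∧
        SolitonCondensate.SolvesNDR (SolitonCondensate.bandsPos N lam) (fun _ => 0)
          (fun η => 4 * η ^ 3) v ∧
        -- `u` is nonnegative on the positive bands
        (∀ η ∈ SolitonCondensate.bandsPos N lam \ SolitonCondensate.branchPoints N lam,
          0 ≤ (u η).re) := by
  obtain ⟨S, hS1, hS2, hSo, hSg⟩ := exists_real_numeratorP hpos hmono
  obtain ⟨W, hWo, hWg, hW⟩ := exists_real_numeratorQ hpos hmono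
  have hS := isNumeratorP_map hpos hmono hS1 hS2 hSo hSg
  refine ⟨⟨_, hS, fun P hP => hP.unique hpos hmono hS⟩,
    ⟨_, hW, fun Q hQ => hQ.unique hpos hmono hW⟩, fun P Q hP hQ u v hu hv => ?_⟩
  -- Uniqueness identifies the given complex numerators with the real ones just constructed.
  obtain rfl := hP.unique hpos hmono hS
  obtain rfl := hQ.unique hpos hmono hW
  rw [dp_map] at hu
  rw [dq_map] at hv
  obtain rfl : u = fun η : ℝ => density N lam ((1 / Real.pi : ℝ) • S) η := funext hu
  obtain rfl : v = fun η : ℝ => density N lam ((12 / Real.pi : ℝ) • W) η := funext hv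
  have hSres := tendsto_residual_dp (lam := lam) hS1 hS2
  have hWres := tendsto_residual_dq hW.2.2
  have hpi := Real.pi_ne_zero
  refine ⟨fun η hη => ⟨density_neg_of_mem hpos hmono (smul_odd hSo) hη.1,
      density_neg_of_mem hpos hmono (smul_odd hWo) hη.1, density_im_of_mem hpos hmono _ hη.1,
      density_im_of_mem hpos hmono _ hη.1⟩,
    integrableOn_bands_density hpos hmono _, integrableOn_bands_density hpos hmono _,
    fun η hη => ⟨?_, ?_⟩,
    solvesNDR_density hpos hmono (smul_odd hSo) hSres (gapIntegral_smul_eq_zero hSg) fun η => ?_,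
    solvesNDR_density hpos hmono (smul_odd hWo) hWres (gapIntegral_smul_eq_zero hWg) fun η => ?_,
    fun η hη => ?_⟩
  · have := hasHilbertTransform_density hpos hmono hSres hη.1 hη.2
    simpa using this
  · have := hasHilbertTransform_density hpos hmono hWres hη.1 hη.2
    rw [eval_mul, eval_C, eval_pow, eval_X] at this
    convert this using 1
    push_cast
    ring
  · simp only [eval_C, intervalIntegral.integral_const, smul_eq_mul]
    field_simp
    ring
  · simp only [eval_mul, eval_C, eval_pow, eval_X, intervalIntegral.integral_const_mul,
      integral_pow]
    field_simp
    ring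
  · simp only [density_smul, Complex.re_ofReal_mul]
    exact mul_nonneg (by positivity) (density_re_nonneg hpos hmono hS1 hS2 hSo hSg hη.1)
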